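/- Let $Z$ be a standard normal random variable and let $\lambda:=\ln\frac{2e^3}{9}=1.495\ldots$. All random variables below are defined on a probability space with probability measure $\mathsf P$. (1) Let $\eta_1,\eta_2,\dots$ be independent (not necessarily identically distributed) zero-mean real random variables with $|\eta_i|\le 1$ almost surely for all $i$, and let $\mathbf x_1,\mathbf x_2,\dots$ be non-random vectors in a real or complex Hilbert space $(H,\|\cdot\|)$ with $\sum_i\|\mathbf x_i\|^2=1$. Then the partial sums of $\eta_1\mathbf x_1+\eta_2\mathbf x_2+\cdots$ converge in $H$ almost surely, and $$\mathsf P\bigl(\|\eta_1\mathbf x_1+\eta_2\mathbf x_2+\cdots\|\ge x\bigr)\le\min\Bigl(\frac1{x^2},\ \mathsf P\bigl(|Z|\ge x-\tfrac{\lambda}{x}\bigr)\Bigr)\qquad\text{for all }x>0.$$ (2) Let $(S_n)_{n\ge0}$ be a real-valued martingale (with respect to some filtration) with $S_0=0$ almost surely and differences $X_i:=S_i-S_{i-1}$, $i\ge1$, such that $\sum_{i\ge1}\operatorname{ess\,sup}|X_i|^2\le1$. Then for all $n\ge0$ and all $x>0$, $$\mathsf P(S_n\ge x)\le\min\Bigl(e^{-x^2/2},\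 \mathsf P\bigl(Z\ge x-\tfrac{\lambda}{x}\bigr)\Bigr)\quad\text{and}\quad \mathsf P(|S_n|\ge x)\le\min\Bigl(\frac1{x^2},\ \mathsf P\bigl(|Z|\ge x-\tfrac{\lambda}{x}\bigr)\Bigr).$$ -/

import Mathlib

open MeasureTheory ProbabilityTheory Filter Topology
open scoped ENNReal

noncomputable section

namespace BoundedSums

/-- The constant `ln (2 e ^ 3 / 9) = 1.495...`. -/
def lam : ℝ := Real.log (2 * Real.exp 3 / 9)

/-- `P(Z ≥ t)` for a standard normal random variable `Z`. -/
def normalTail (t : ℝ) : ℝ := (gaussianReal 0 1).real {z : ℝ | t ≤ z}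

/-- `P(|Z| ≥ t)` for a standard normal random variable `Z`. -/
def normalTwoTail (t : ℝ) : ℝ := (gaussianReal 0 1).real {z : ℝ | t ≤ |z|}

/-- The one-sided bound `W(x) = min (e^{-x²/2}, P(Z ≥ x - λ/x))`, used for `x > 0`. -/
def oneSidedBound (x : ℝ) : ℝ := min (Real.exp (-x ^ 2 / 2)) (normalTail (x - lam / x))

/-- The two-sided bound `min (1/x², P(|Z| ≥ x - λ/x))`, used for `x > 0`. -/
def twoSidedBound (x : ℝ) : ℝ := min (1 / x ^ 2) (normalTwoTail (x - lam / x))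

end BoundedSums

end

/-!
A third-moment comparison, after Eaton and Pinelis. For `S = ∑ ξ i • v i` with `∑ ‖v i‖ ^ 2 ≤ 1`,
the increments are replaced one at a time by centred Gaussian ones of the same variance, and
`E (S - t)₊³` can only increase. Convexity reduces a bounded increment to a symmetric two-point
one, and the latter is dominated by a Gaussian because `s ↦ (p + √s)₊³ + (p - √s)₊³` is convex. In a
Hilbert space the same argument runs on the radial function `(‖a‖ - t)₊³ + (-‖a‖ - t)₊³`, whose
values at `a ± v` are controlled through the parallelogram law. By Markov's inequality and
log-concavity of the normal tail `Q`, the choice `t = x - 3 / h x`, where `h` is the hazard rate,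
yields `P (S ≥ x) ≤ (2 e³ / 9) Q x = e ^ λ Q x`, and twice this bound for `‖S‖`.

For `x ≥ √λ` one has `e ^ λ Q x ≤ Q (x - λ / x)`. For smaller `x` the two-sided bound on the tail is
trivial because `P (|Z| ≥ x - λ / x) = 1`, and the one-sided bound follows from Cantelli's
inequality `P (S ≥ x) ≤ 1 / (1 + x²)`. Replacing the cubes by squares and exponentials in the same
scheme gives Chebyshev's, Cantelli's and the exponential inequality. Almost sure convergence comes
from Kolmogorov's maximal inequality, and the tail bound survives in the limit because it is
continuous in `x`.
-/

namespace BoundedSums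

open scoped NNReal

section Convexity

lemma convexOn_add_sub_le_add {s : Set ℝ} {f : ℝ → ℝ} (hf : ConvexOn ℝ s f) {x y z : ℝ}
    (hx : x ∈ s) (hz : z ∈ s) (hy : y ∈ Set.Icc x z) : f y + f (x + z - y) ≤ f x + f z := by
  rw [← segment_eq_Icc (hy.1.trans hy.2)] at hy
  obtain ⟨a, b, ha, hb, hab, rfl⟩ := hy
  have hreflect : x + z - (a • x + b • z) = b • x + a • z := by
    simp only [smul_eq_mul]
    linear_combination -(x + z) * hab
  rw [hreflect]
  have h₁ := hf.2 hx hz ha hb hab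
  have h₂ := hf.2 hx hz hb ha (by rwa [add_comm])
  simp only [smul_eq_mul] at *
  linear_combination h₁ + h₂ + (f x + f z) * hab

lemma convexOn_integral {F α : Type*} [AddCommMonoid F] [Module ℝ F] [MeasurableSpace α]
    {μ : Measure α} {s : Set F} {f : F → α → ℝ} (hs : Convex ℝ s)
    (hf : ∀ᵐ z ∂μ, ConvexOn ℝ s fun y => f y z) (hi : ∀ y ∈ s, Integrable (f y) μ) :
    ConvexOn ℝ s fun y => ∫ z, f y z ∂μ := by
  refine ⟨hs, fun x hx y hy a b ha hb hab => ?_⟩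
  have hix := (hi x hx).const_mul a
  have hiy := (hi y hy).const_mul b
  calc ∫ z, f (a • x + b • y) z ∂μ ≤ ∫ z, (a * f x z + b * f y z) ∂μ :=
        integral_mono_ae (hi _ (hs hx hy ha hb hab)) (hix.add hiy)
          (hf.mono fun z hz => hz.2 hx hy ha hb hab)
    _ = a • ∫ z, f x z ∂μ + b • ∫ z, f y z ∂μ := by
        rw [integral_add hix hiy, integral_const_mul, integral_const_mul, smul_eq_mul, smul_eq_mul]

lemma monotoneOn_Ici_of_convexOn_of_even {f : ℝ → ℝ} (hf : ConvexOn ℝ Set.univ f)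
    (heven : f.Even) : MonotoneOn f (Set.Ici 0) := by
  intro y hy z _ hyz
  have hy' : (0 : ℝ) ≤ y := hy
  simpa [heven z] using hf.le_max_of_mem_Icc (Set.mem_univ (-z)) (Set.mem_univ z)
    ⟨by linarith, hyz⟩

lemma convexOn_comp_norm_of_even {E : Type*} [SeminormedAddCommGroup E] [NormedSpace ℝ E]
    {f : ℝ → ℝ} (hf : ConvexOn ℝ Set.univ f) (heven : f.Even) :
    ConvexOn ℝ Set.univ fun a : E => f ‖a‖ := by
  have himage : norm '' (Set.univ : Set E) ⊆ Set.Ici 0 := by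
    rintro _ ⟨a, -, rfl⟩
    exact norm_nonneg a
  have hconvex : Convex ℝ (norm '' (Set.univ : Set E)) :=
    (Set.image_univ ▸ isPreconnected_range continuous_norm).ordConnected.convex
  exact (hf.subset (Set.subset_univ _) hconvex).comp convexOn_univ_norm
    ((monotoneOn_Ici_of_convexOn_of_even hf heven).mono himage)

lemma add_comp_norm_le_of_convexOn_comp_sqrt {E : Type*} [SeminormedAddCommGroup E]
    [InnerProductSpace ℝ E] {g : ℝ → ℝ} (heven : g.Even)
    (hg : ConvexOn ℝ (Set.Ici 0) fun s => g √s) (a x : E) :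
    g ‖a + x‖ + g ‖a - x‖ ≤ g (‖a‖ + ‖x‖) + g (‖a‖ - ‖x‖) := by
  have hg_sqrt : ∀ r, g √(r ^ 2) = g r := fun r => by
    rw [Real.sqrt_sq_eq_abs]
    rcases abs_choice r with h | h <;> simp only [h, heven r]
  have hparallelogram :
      (‖a‖ - ‖x‖) ^ 2 + (‖a‖ + ‖x‖) ^ 2 - ‖a + x‖ ^ 2 = ‖a - x‖ ^ 2 := by
    linear_combination -parallelogram_law_with_norm ℝ a x
  have hlower : |‖a‖ - ‖x‖| ≤ ‖a + x‖ := by simpa using abs_norm_sub_norm_le a (-x)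
  have h := convexOn_add_sub_le_add hg (sq_nonneg (‖a‖ - ‖x‖)) (sq_nonneg (‖a‖ + ‖x‖))
    (y := ‖a + x‖ ^ 2) ⟨by rw [← sq_abs]; gcongr, by gcongr; exact norm_add_le a x⟩
  simp only [hparallelogram, hg_sqrt] at h
  linarith

end Convexity

section CubePos

/-- The cube `y₊³` of the positive part, whose translates are the moments compared below. -/
def cubePos (y : ℝ) : ℝ := max y 0 ^ 3

lemma cubePos_nonneg (y : ℝ) : 0 ≤ cubePos y := by unfold cubePos; positivity

@[fun_prop]
lemma continuous_cubePos : Continuous cubePos := by unfold cubePos; fun_prop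

lemma cubePos_le_abs_pow (y : ℝ) : cubePos y ≤ |y| ^ 3 := by
  unfold cubePos
  gcongr
  exact max_le (le_abs_self y) (abs_nonneg y)

lemma convexOn_cubePos : ConvexOn ℝ Set.univ cubePos :=
  ((convexOn_id convex_univ).sup (convexOn_const 0 convex_univ)).pow
    (fun _ _ => le_max_right _ _) 3

lemma cubePos_of_nonneg {y : ℝ} (hy : 0 ≤ y) : cubePos y = y ^ 3 := by
  rw [cubePos, max_eq_left hy]

lemma cubePos_of_nonpos {y : ℝ} (hy : y ≤ 0) : cubePos y = 0 := by
  rw [cubePos, max_eq_right hy, zero_pow three_ne_zero]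

lemma hasDerivAt_cubePos (y : ℝ) : HasDerivAt cubePos (3 * max y 0 ^ 2) y := by
  have hne : ∀ z : ℝ, z ≠ 0 → HasDerivAt cubePos (3 * max z 0 ^ 2) z := by
    intro z hz
    rcases lt_or_gt_of_ne hz with h | h
    · have hloc : cubePos =ᶠ[𝓝 z] fun _ => 0 :=
        (eventually_le_nhds h).mono fun _ hw => cubePos_of_nonpos hw
      simpa [max_eq_right h.le] using (hasDerivAt_const z (0 : ℝ)).congr_of_eventuallyEq hloc
    · have hloc : cubePos =ᶠ[𝓝 z] fun w => w ^ 3 :=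
        (eventually_ge_nhds h).mono fun _ hw => cubePos_of_nonneg hw
      simpa [max_eq_left h.le] using (hasDerivAt_pow 3 z).congr_of_eventuallyEq hloc
  rcases eq_or_ne y 0 with rfl | hy
  · exact hasDerivAt_of_hasDerivAt_of_ne hne continuous_cubePos.continuousAt (by fun_prop)
  · exact hne y hy

lemma monotoneOn_sq_max_sub_div {a : ℝ} (ha : 0 ≤ a) :
    MonotoneOn (fun r : ℝ => max (r - a) 0 ^ 2 / r) (Set.Ioi 0) := by
  have hfactor : Set.EqOn (fun r => max (r - a) 0 * max (1 - a / r) 0)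
      (fun r : ℝ => max (r - a) 0 ^ 2 / r) (Set.Ioi 0) := by
    intro r (hr : 0 < r)
    have : max (1 - a / r) 0 = max (r - a) 0 / r := by
      rw [← max_div_div_right hr.le, zero_div, sub_div, div_self hr.ne']
    simp only [this]
    ring
  refine MonotoneOn.congr (fun r (hr : 0 < r) r' _ hrr' => ?_) hfactor
  gcongr

lemma convexOn_cubePos_sqrt_sub {a : ℝ} (ha : 0 ≤ a) :
    ConvexOn ℝ (Set.Ici 0) fun s => cubePos (√s - a) := by
  have hderiv : ∀ s ∈ Set.Ioi (0 : ℝ), HasDerivAt (fun s => cubePos (√s - a))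
      (3 / 2 * (max (√s - a) 0 ^ 2 / √s)) s := fun s hs =>
    ((hasDerivAt_cubePos _).comp s ((Real.hasDerivAt_sqrt (ne_of_gt hs)).sub_const a)).congr_deriv
      (by ring)
  refine MonotoneOn.convexOn_of_deriv (convex_Ici 0) (by fun_prop) ?_ ?_ <;> rw [interior_Ici]
  · exact fun s hs => (hderiv s hs).differentiableAt.differentiableWithinAt
  · intro s hs s' hs' hss'
    rw [(hderiv s hs).deriv, (hderiv s' hs').deriv]
    gcongr 3 / 2 * ?_
    exact monotoneOn_sq_max_sub_div ha (Real.sqrt_pos.2 hs) (Real.sqrt_pos.2 hs')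
      (Real.sqrt_le_sqrt hss')

lemma cubePos_add_cubePos_sub (p r : ℝ) : cubePos (p + r) + cubePos (p - r) =
    p ^ 3 + |p| ^ 3 + 3 * (p + |p|) * r ^ 2 + cubePos (|r| - |p|) := by
  wlog hr : 0 ≤ r generalizing r
  · have := this (-r) (by linarith)
    rw [abs_neg, neg_sq, sub_neg_eq_add, ← sub_eq_add_neg] at this
    rw [← this, add_comm]
  rw [abs_of_nonneg hr]
  rcases le_total 0 p with hp | hp
  · rw [abs_of_nonneg hp, cubePos_of_nonneg (by linarith : 0 ≤ p + r)]
    rcases le_total r p with h | h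
    · rw [cubePos_of_nonneg (by linarith), cubePos_of_nonpos (by linarith)]
      ring
    · rw [cubePos_of_nonpos (by linarith), cubePos_of_nonneg (by linarith)]
      ring
  · rw [abs_of_nonpos hp, cubePos_of_nonpos (by linarith : p - r ≤ 0), sub_neg_eq_add, add_comm r]
    ring

lemma convexOn_cubePos_add_sqrt_add_sub_sqrt (p : ℝ) :
    ConvexOn ℝ (Set.Ici 0) fun s => cubePos (p + √s) + cubePos (p - √s) := by
  have hp : 0 ≤ 3 * (p + |p|) := by linarith [neg_abs_le p]
  refine (((convexOn_id (convex_Ici 0)).smul hp).add_const (p ^ 3 + |p| ^ 3)).add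
    (convexOn_cubePos_sqrt_sub (abs_nonneg p)) |>.congr fun s (hs : 0 ≤ s) => ?_
  simp only [cubePos_add_cubePos_sub, Real.sq_sqrt hs, abs_of_nonneg (Real.sqrt_nonneg s),
    Pi.add_apply, smul_eq_mul, id]
  ring

end CubePos

section GaussCube

/-- The third positive-part moment `E (y + √R Z)₊³` of a shifted normal variable of variance `R`.
In the comparison, `R` is the variance of the increments already replaced by Gaussian ones. -/
noncomputable def gaussCube (R : ℝ≥0) (y : ℝ) : ℝ := ∫ z, cubePos (y + z) ∂(gaussianReal 0 R)

instance isNegInvariant_gaussianReal (R : ℝ≥0) : (gaussianReal 0 R).IsNegInvariant :=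
  ⟨by rw [Measure.neg, show Neg.neg = fun x : ℝ => -x from rfl, gaussianReal_map_neg, neg_zero]⟩

lemma integrable_id_gaussianReal (m : ℝ) (R : ℝ≥0) :
    Integrable (fun z => z) (gaussianReal m R) :=
  memLp_one_iff_integrable.1 (memLp_id_gaussianReal 1)

lemma integrable_sq_gaussianReal (m : ℝ) (R : ℝ≥0) :
    Integrable (fun z => z ^ 2) (gaussianReal m R) :=
  (memLp_id_gaussianReal 2).integrable_sq

lemma integral_sq_gaussianReal (R : ℝ≥0) : ∫ z, z ^ 2 ∂(gaussianReal 0 R) = R := by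
  have h := variance_id_gaussianReal (μ := 0) (v := R)
  rw [variance_eq_integral (by fun_prop)] at h
  simpa using h

lemma integrable_cubePos_add_gaussianReal (m : ℝ) (R : ℝ≥0) (y : ℝ) :
    Integrable (fun z => cubePos (y + z)) (gaussianReal m R) := by
  have hL : MemLp (fun z : ℝ => y + z) 3 (gaussianReal m R) :=
    (memLp_const y).add (memLp_id_gaussianReal 3)
  refine (hL.integrable_norm_pow three_ne_zero).mono'
    (by fun_prop : Continuous _).aestronglyMeasurable (ae_of_all _ fun z => ?_)
  rw [Real.norm_of_nonneg (cubePos_nonneg _)]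
  exact cubePos_le_abs_pow _

lemma gaussCube_nonneg (R : ℝ≥0) (y : ℝ) : 0 ≤ gaussCube R y :=
  integral_nonneg fun _ => cubePos_nonneg _

lemma convexOn_gaussCube (R : ℝ≥0) : ConvexOn ℝ Set.univ (gaussCube R) :=
  convexOn_integral convex_univ (ae_of_all _ fun z => convexOn_cubePos.translate_left z)
    fun _ _ => integrable_cubePos_add_gaussianReal _ _ _

@[fun_prop]
lemma continuous_gaussCube (R : ℝ≥0) : Continuous (gaussCube R) :=
  continuousOn_univ.1 ((convexOn_gaussCube R).continuousOn isOpen_univ)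

lemma cubePos_le_gaussCube (R : ℝ≥0) (y : ℝ) : cubePos y ≤ gaussCube R y := by
  have hmean : ∫ z, (y + z) ∂(gaussianReal 0 R) = y := by
    rw [integral_add (integrable_const y) (integrable_id_gaussianReal 0 R)]
    simp [integral_id_gaussianReal]
  have := convexOn_cubePos.map_integral_le (μ := gaussianReal 0 R) (f := fun z => y + z)
    continuous_cubePos.continuousOn isClosed_univ (by simp)
    ((integrable_const y).add (integrable_id_gaussianReal 0 R))
    (integrable_cubePos_add_gaussianReal _ _ _)
  rwa [hmean] at this

lemma pow_le_gaussCube (R : ℝ≥0) {s y : ℝ} (hs : 0 ≤ s) (hsy : s ≤ y) : s ^ 3 ≤ gaussCube R y :=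
  (pow_le_pow_left₀ hs (le_max_of_le_left hsy) 3).trans (cubePos_le_gaussCube R y)

lemma integral_cubePos_add_add_cubePos_sub (R : ℝ≥0) (p : ℝ) :
    Integrable (fun z => cubePos (p + z) + cubePos (p - z)) (gaussianReal 0 R) ∧
      ∫ z, (cubePos (p + z) + cubePos (p - z)) ∂(gaussianReal 0 R) = 2 * gaussCube R p := by
  have hadd := integrable_cubePos_add_gaussianReal 0 R p
  have hsub : Integrable (fun z => cubePos (p - z)) (gaussianReal 0 R) := by
    simpa only [sub_eq_add_neg] using hadd.comp_neg
  refine ⟨hadd.add hsub, ?_⟩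
  have hneg := integral_neg_eq_self (fun z => cubePos (p + z)) (gaussianReal 0 R)
  simp only [← sub_eq_add_neg] at hneg
  rw [integral_add hadd hsub, hneg, gaussCube, two_mul]

lemma cubePos_add_cubePos_sub_le_gaussCube (c p : ℝ) :
    cubePos (p + c) + cubePos (p - c) ≤ 2 * gaussCube (‖c‖₊ ^ 2) p := by
  have hsqrt : ∀ z : ℝ, cubePos (p + √(z ^ 2)) + cubePos (p - √(z ^ 2)) =
      cubePos (p + z) + cubePos (p - z) := fun z => by
    simp only [cubePos_add_cubePos_sub, Real.sqrt_sq_eq_abs, abs_abs, sq_abs]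
  obtain ⟨hint, heq⟩ := integral_cubePos_add_add_cubePos_sub (‖c‖₊ ^ 2) p
  have := (convexOn_cubePos_add_sqrt_add_sub_sqrt p).map_integral_le
    (μ := gaussianReal 0 (‖c‖₊ ^ 2)) (f := fun z => z ^ 2)
    (by fun_prop : Continuous _).continuousOn isClosed_Ici (ae_of_all _ sq_nonneg)
    (integrable_sq_gaussianReal _ _) (by simpa only [Function.comp_def, hsqrt] using hint)
  simpa only [integral_sq_gaussianReal, NNReal.coe_pow, coe_nnnorm, Real.norm_eq_abs, sq_abs,
    hsqrt, heq] using this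

lemma integrable_cubePos_add_conv (R R' : ℝ≥0) (y : ℝ) :
    Integrable (fun z => cubePos (y + z)) (gaussianReal 0 R ∗ gaussianReal 0 R') := by
  rw [gaussianReal_conv_gaussianReal]
  exact integrable_cubePos_add_gaussianReal _ _ _

lemma integrable_gaussCube_add (R R' : ℝ≥0) (y : ℝ) :
    Integrable (fun z => gaussCube R' (y + z)) (gaussianReal 0 R) := by
  have h := (integrable_cubePos_add_conv R R' y).comp_measurable measurable_add
  simpa only [gaussCube, add_assoc, Function.comp_def] using h.integral_prod_left

lemma gaussCube_add (R R' : ℝ≥0) (y : ℝ) :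
    gaussCube (R + R') y = ∫ z, gaussCube R' (y + z) ∂(gaussianReal 0 R) := by
  have h := integral_conv (integrable_cubePos_add_conv R R' y)
  rw [gaussianReal_conv_gaussianReal, add_zero] at h
  simpa only [gaussCube, add_assoc] using h

lemma gaussCube_add_gaussCube_sub_le (R : ℝ≥0) (c p : ℝ) :
    gaussCube R (p + c) + gaussCube R (p - c) ≤ 2 * gaussCube (R + ‖c‖₊ ^ 2) p := by
  have hint := integrable_cubePos_add_gaussianReal 0 R
  rw [gaussCube_add, ← integral_const_mul, gaussCube, gaussCube, ← integral_add (hint _) (hint _)]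
  refine integral_mono ((hint _).add (hint _)) ((integrable_gaussCube_add _ _ _).const_mul 2)
    fun z => ?_
  have := cubePos_add_cubePos_sub_le_gaussCube c (p + z)
  rwa [add_right_comm, add_sub_right_comm] at this

lemma convexOn_gaussCube_add_sqrt_add_sub_sqrt (R : ℝ≥0) (p : ℝ) :
    ConvexOn ℝ (Set.Ici 0) fun s => gaussCube R (p + √s) + gaussCube R (p - √s) := by
  have hint := integrable_cubePos_add_gaussianReal 0 R
  refine (convexOn_integral (μ := gaussianReal 0 R) (convex_Ici 0) (ae_of_all _ fun z => ?_)
    fun s _ => (hint (p + √s)).add (hint (p - √s))).congr fun s _ => ?_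
  · simpa only [Pi.add_apply, add_right_comm, add_sub_right_comm] using
      convexOn_cubePos_add_sqrt_add_sub_sqrt (p + z)
  · exact integral_add (hint _) (hint _)

/-- The radial function `a ↦ gaussCube R (q + ‖a‖) + gaussCube R (q - ‖a‖)` on a normed space;
at `q = -t` it dominates `(‖a‖ - t)₊³`. -/
noncomputable def radialCube {E : Type*} [SeminormedAddCommGroup E] (q : ℝ) (R : ℝ≥0) (a : E) : ℝ :=
  gaussCube R (q + ‖a‖) + gaussCube R (q - ‖a‖)

lemma even_gaussCube_add_add_sub (R : ℝ≥0) (q : ℝ) :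
    (fun r => gaussCube R (q + r) + gaussCube R (q - r)).Even := fun r => by
  simp only [sub_neg_eq_add, ← sub_eq_add_neg, add_comm]

lemma radialCube_add_radialCube_sub_le {E : Type*} [SeminormedAddCommGroup E]
    [InnerProductSpace ℝ E] (q : ℝ) (R : ℝ≥0) (a x : E) :
    radialCube q R (a + x) + radialCube q R (a - x) ≤ 2 * radialCube q (R + ‖x‖₊ ^ 2) a := by
  have hcollinear := add_comp_norm_le_of_convexOn_comp_sqrt (even_gaussCube_add_add_sub R q)
    (convexOn_gaussCube_add_sqrt_add_sub_sqrt R q) a x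
  have hplus := gaussCube_add_gaussCube_sub_le R ‖x‖ (q + ‖a‖)
  have hminus := gaussCube_add_gaussCube_sub_le R ‖x‖ (q - ‖a‖)
  rw [nnnorm_norm] at hplus hminus
  simp only [← add_assoc, ← sub_sub, ← add_sub_assoc, sub_sub_eq_add_sub] at *
  unfold radialCube
  rw [add_sub_right_comm q ‖x‖ ‖a‖] at hcollinear
  linarith

@[fun_prop]
lemma continuous_radialCube {E : Type*} [SeminormedAddCommGroup E] (q : ℝ) (R : ℝ≥0) :
    Continuous (radialCube (E := E) q R) := by
  unfold radialCube
  fun_prop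

lemma convexOn_radialCube {E : Type*} [SeminormedAddCommGroup E] [NormedSpace ℝ E]
    (q : ℝ) (R : ℝ≥0) : ConvexOn ℝ Set.univ (radialCube (E := E) q R) := by
  have hplus := (convexOn_gaussCube R).translate_right q
  have hminus := hplus.comp_linearMap (-LinearMap.id)
  exact convexOn_comp_norm_of_even (hplus.add hminus) (even_gaussCube_add_add_sub R q)

end GaussCube

section Monotonicity

variable {D : Set ℝ} {f f' : ℝ → ℝ}

lemma monotoneOn_of_hasDerivAt_nonneg (hD : Convex ℝ D) (hf : ∀ x ∈ D, HasDerivAt f (f' x) x)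
    (hf' : ∀ x ∈ D, 0 ≤ f' x) : MonotoneOn f D :=
  monotoneOn_of_hasDerivWithinAt_nonneg hD (fun x hx => (hf x hx).continuousAt.continuousWithinAt)
    (fun x hx => (hf x (interior_subset hx)).hasDerivWithinAt)
    fun x hx => hf' x (interior_subset hx)

lemma antitoneOn_of_hasDerivAt_nonpos (hD : Convex ℝ D) (hf : ∀ x ∈ D, HasDerivAt f (f' x) x)
    (hf' : ∀ x ∈ D, f' x ≤ 0) : AntitoneOn f D :=
  antitoneOn_of_hasDerivWithinAt_nonpos hD (fun x hx => (hf x hx).continuousAt.continuousWithinAt)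
    (fun x hx => (hf x (interior_subset hx)).hasDerivWithinAt)
    fun x hx => hf' x (interior_subset hx)

lemma le_of_antitoneOn_Ici_of_tendsto {a l : ℝ} (hf : AntitoneOn f (Set.Ici a))
    (hlim : Tendsto f atTop (𝓝 l)) : l ≤ f a :=
  le_of_tendsto hlim ((eventually_ge_atTop a).mono fun _ hy => hf Set.self_mem_Ici hy hy)

end Monotonicity

section NormalTail

local notation "φ" => gaussianPDFReal 0 1

lemma stdGaussianPDFReal_eq : φ = fun x => (√(2 * Real.pi))⁻¹ * Real.exp (-x ^ 2 / 2) := by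
  funext x
  simp [gaussianPDFReal]

lemma stdGaussianPDFReal_pos (x : ℝ) : 0 < φ x := gaussianPDFReal_pos _ _ _ one_ne_zero

lemma hasDerivAt_stdGaussianPDFReal (x : ℝ) : HasDerivAt φ (-x * φ x) x := by
  have hexponent : HasDerivAt (fun x : ℝ => -x ^ 2 / 2) (-x) x :=
    (((hasDerivAt_pow 2 x).neg).div_const 2).congr_deriv (by norm_num; ring)
  rw [stdGaussianPDFReal_eq]
  exact (hexponent.exp.const_mul _).congr_deriv (by ring)

lemma continuous_stdGaussianPDFReal : Continuous φ :=
  continuous_iff_continuousAt.2 fun x => (hasDerivAt_stdGaussianPDFReal x).continuousAt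

lemma tendsto_stdGaussianPDFReal_atTop : Tendsto φ atTop (𝓝 0) := by
  have hexponent : Tendsto (fun x : ℝ => -x ^ 2 / 2) atTop atBot := by
    simp only [neg_div]
    exact tendsto_neg_atTop_atBot.comp
      ((tendsto_pow_atTop two_ne_zero).atTop_div_const two_pos)
  rw [stdGaussianPDFReal_eq]
  simpa using (Real.tendsto_exp_atBot.comp hexponent).const_mul (√(2 * Real.pi))⁻¹

lemma nullSingletonClass_stdGaussian : NullSingletonClass (gaussianReal 0 1) :=
  nullSingletonClass_gaussianReal one_ne_zero

lemma normalTail_eq_integral (t : ℝ) : normalTail t = ∫ x in Set.Ioi t, φ x := by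
  have := nullSingletonClass_stdGaussian
  have hIoi : normalTail t = (gaussianReal 0 1).real (Set.Ioi t) :=
    measureReal_congr Ioi_ae_eq_Ici.symm
  rw [hIoi, measureReal_def, gaussianReal_apply_eq_integral _ one_ne_zero,
    ENNReal.toReal_ofReal (integral_nonneg fun x => (stdGaussianPDFReal_pos x).le)]

lemma normalTail_eq_one_sub_cdf (t : ℝ) : normalTail t = 1 - cdf (gaussianReal 0 1) t := by
  have := nullSingletonClass_stdGaussian
  rw [cdf_eq_real, ← probReal_compl_eq_one_sub measurableSet_Iic, Set.compl_Iic]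
  exact measureReal_congr Ioi_ae_eq_Ici.symm

lemma hasDerivAt_normalTail (x : ℝ) : HasDerivAt normalTail (-φ x) x := by
  have hint : Integrable φ := integrable_gaussianPDFReal 0 1
  have hcont := continuous_stdGaussianPDFReal
  have hprimitive : normalTail = fun u => normalTail 0 - ∫ x in (0 : ℝ)..u, φ x := by
    funext u
    rw [normalTail_eq_integral, normalTail_eq_integral,
      ← intervalIntegral.integral_Ioi_sub_Ioi' hint.integrableOn hint.integrableOn, sub_sub_cancel]
  rw [hprimitive]
  exact (intervalIntegral.integral_hasDerivAt_right (hcont.intervalIntegrable 0 x)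
    (hcont.stronglyMeasurableAtFilter _ _) hcont.continuousAt).const_sub _

@[fun_prop]
lemma continuous_normalTail : Continuous normalTail :=
  continuous_iff_continuousAt.2 fun x => (hasDerivAt_normalTail x).continuousAt

lemma strictAnti_normalTail : StrictAnti normalTail :=
  strictAnti_of_hasDerivAt_neg hasDerivAt_normalTail fun x =>
    neg_lt_zero.2 (stdGaussianPDFReal_pos x)

lemma normalTail_pos (x : ℝ) : 0 < normalTail x :=
  measureReal_nonneg.trans_lt (strictAnti_normalTail (lt_add_one x))

lemma tendsto_normalTail_atTop : Tendsto normalTail atTop (𝓝 0) := by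
  simpa [funext normalTail_eq_one_sub_cdf] using (tendsto_cdf_atTop (gaussianReal 0 1)).const_sub 1

lemma normalTail_neg (x : ℝ) : normalTail (-x) = 1 - normalTail x := by
  rw [normalTail_eq_one_sub_cdf x, sub_sub_cancel, cdf_eq_real, measureReal_def,
    ← Measure.measure_neg (gaussianReal 0 1)]
  exact congrArg (gaussianReal 0 1).real (by ext z; simp)

lemma normalTail_zero : normalTail 0 = 1 / 2 := by
  have := normalTail_neg 0
  rw [neg_zero] at this
  linarith

lemma normalTwoTail_eq (t : ℝ) : normalTwoTail t = 2 * normalTail (max t 0) := by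
  rcases lt_or_ge 0 t with ht | ht
  · have hsplit : {z : ℝ | t ≤ |z|} = Set.Ici t ∪ -Set.Ici t := by
      ext z
      simp [le_abs, le_neg]
    have hdisjoint : Disjoint (Set.Ici t) (-Set.Ici t) :=
      Set.disjoint_left.2 fun z (h₁ : t ≤ z) (h₂ : t ≤ -z) => by linarith
    rw [normalTwoTail, hsplit, measureReal_union hdisjoint measurableSet_Ici.neg,
      max_eq_left ht.le, two_mul, measureReal_def _ (-Set.Ici t), Measure.measure_neg]
    rfl
  · have huniv : {z : ℝ | t ≤ |z|} = Set.univ :=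
      Set.eq_univ_of_forall fun z => ht.trans (abs_nonneg z)
    rw [normalTwoTail, huniv, max_eq_right ht, normalTail_zero, probReal_univ]
    norm_num

@[fun_prop]
lemma continuous_normalTwoTail : Continuous normalTwoTail := by
  rw [funext normalTwoTail_eq]
  fun_prop

lemma normalTail_le_exp_div_two {y : ℝ} (hy : 0 ≤ y) :
    normalTail y ≤ Real.exp (-y ^ 2 / 2) / 2 := by
  have hint : Integrable φ := integrable_gaussianPDFReal 0 1
  have hpdf : ∀ x ∈ Set.Ioi (0 : ℝ), φ (x + y) ≤ Real.exp (-y ^ 2 / 2) * φ x := by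
    intro x hx
    simp only [stdGaussianPDFReal_eq]
    rw [mul_left_comm, ← Real.exp_add]
    gcongr
    nlinarith [mul_nonneg (le_of_lt hx) hy]
  calc normalTail y = ∫ x in Set.Ioi 0, φ (x + y) := by
        rw [normalTail_eq_integral]
        simpa using ((measurePreserving_add_right volume y).setIntegral_preimage_emb
          (measurableEmbedding_addRight y) φ (Set.Ioi y)).symm
    _ ≤ ∫ x in Set.Ioi 0, Real.exp (-y ^ 2 / 2) * φ x :=
        setIntegral_mono_on (hint.comp_add_right y).integrableOn (hint.const_mul _).integrableOn
          measurableSet_Ioi hpdf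
    _ = Real.exp (-y ^ 2 / 2) / 2 := by
        rw [integral_const_mul, ← normalTail_eq_integral, normalTail_zero, mul_one_div]

end NormalTail

section Hazard

local notation "φ" => gaussianPDFReal 0 1

/-- The hazard rate (inverse Mills ratio) of the standard normal distribution, that is, minus the
logarithmic derivative of `normalTail`. -/
noncomputable def hazard (x : ℝ) : ℝ := φ x / normalTail x

lemma hazard_pos (x : ℝ) : 0 < hazard x := div_pos (stdGaussianPDFReal_pos x) (normalTail_pos x)

lemma le_hazard (x : ℝ) : x ≤ hazard x := by
  have hderiv : ∀ u ∈ Set.Ici x,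
      HasDerivAt (fun u => φ u - x * normalTail u) ((x - u) * φ u) u := fun u _ =>
    ((hasDerivAt_stdGaussianPDFReal u).sub ((hasDerivAt_normalTail u).const_mul x)).congr_deriv
      (by ring)
  have hanti := antitoneOn_of_hasDerivAt_nonpos (convex_Ici x) hderiv fun u hu =>
    mul_nonpos_of_nonpos_of_nonneg (sub_nonpos.2 hu) (stdGaussianPDFReal_pos u).le
  have hlim : Tendsto (fun u => φ u - x * normalTail u) atTop (𝓝 0) := by
    simpa using tendsto_stdGaussianPDFReal_atTop.sub (tendsto_normalTail_atTop.const_mul x)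
  rw [hazard, le_div_iff₀ (normalTail_pos x), ← sub_nonneg]
  exact le_of_antitoneOn_Ici_of_tendsto (f := fun u => φ u - x * normalTail u) hanti hlim

lemma hasDerivAt_hazard (x : ℝ) : HasDerivAt hazard (hazard x * (hazard x - x)) x := by
  have hQ := (normalTail_pos x).ne'
  refine ((hasDerivAt_stdGaussianPDFReal x).div (hasDerivAt_normalTail x) hQ).congr_deriv ?_
  unfold hazard
  field_simp
  ring

lemma monotone_hazard : Monotone hazard :=
  monotone_of_hasDerivAt_nonneg hasDerivAt_hazard fun x =>
    mul_nonneg (hazard_pos x).le (sub_nonneg.2 (le_hazard x))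

lemma hasDerivAt_log_normalTail (x : ℝ) :
    HasDerivAt (fun u => Real.log (normalTail u)) (-hazard x) x :=
  ((hasDerivAt_normalTail x).log (normalTail_pos x).ne').congr_deriv (neg_div _ _)

lemma concaveOn_log_normalTail : ConcaveOn ℝ Set.univ fun u => Real.log (normalTail u) := by
  have hderiv := fun x => (hasDerivAt_log_normalTail x).deriv
  refine Antitone.concaveOn_univ_of_deriv
    (fun x => (hasDerivAt_log_normalTail x).differentiableAt) fun x y hxy => ?_
  rw [hderiv, hderiv]
  exact neg_le_neg (monotone_hazard hxy)

lemma normalTail_le_mul_exp_hazard (x u : ℝ) :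
    normalTail u ≤ normalTail x * Real.exp (-hazard x * (u - x)) := by
  have htangent :
      Real.log (normalTail u) ≤ Real.log (normalTail x) + -hazard x * (u - x) := by
    have hderiv := hasDerivAt_log_normalTail x
    rcases lt_trichotomy u x with h | rfl | h
    · have := concaveOn_log_normalTail.le_slope_of_hasDerivAt trivial trivial h hderiv
      rw [slope_def_field, le_div_iff₀ (sub_pos.2 h)] at this
      linarith
    · simp
    · have := concaveOn_log_normalTail.slope_le_of_hasDerivAt trivial trivial h hderiv
      rw [slope_def_field, div_le_iff₀ (sub_pos.2 h)] at this
      linarith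
  rw [← Real.log_le_log_iff (normalTail_pos u) (by have := normalTail_pos x; positivity),
    Real.log_mul (normalTail_pos x).ne' (Real.exp_pos _).ne', Real.log_exp]
  exact htangent

end Hazard

section ExponentialTail

lemma lintegral_rpow_mul_exp_neg_mul_Ioi {a h : ℝ} (ha : 0 < a) (hh : 0 < h) :
    ∫⁻ s in Set.Ioi 0, ENNReal.ofReal (s ^ (a - 1) * Real.exp (-(h * s))) =
      ENNReal.ofReal ((1 / h) ^ a * Real.Gamma a) := by
  have hint := Real.integral_rpow_mul_exp_neg_mul_Ioi ha hh
  have hpos : 0 < (1 / h) ^ a * Real.Gamma a := by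
    have := Real.Gamma_pos_of_pos ha
    positivity
  rw [← hint, ofReal_integral_eq_lintegral_ofReal
    (Integrable.of_integral_ne_zero (hint ▸ hpos.ne'))]
  exact (ae_restrict_mem measurableSet_Ioi).mono fun s (hs : 0 < s) => by positivity

lemma integral_pow_le_of_measureReal_le_exp {α : Type*} [MeasurableSpace α] {ν : Measure α}
    [IsFiniteMeasure ν] {f : α → ℝ} (hf : AEMeasurable f ν) (hf_nonneg : 0 ≤ᵐ[ν] f) {B h : ℝ}
    (hh : 0 < h) (htail : ∀ s > 0, ν.real {z | s ≤ f z} ≤ B * Real.exp (-(h * s)))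
    {n : ℕ} (hn : 0 < n) : ∫ z, f z ^ n ∂ν ≤ B * (n.factorial / h ^ n) := by
  have hn' : (0 : ℝ) < n := Nat.cast_pos.2 hn
  have hB : 0 ≤ B :=
    nonneg_of_mul_nonneg_left (measureReal_nonneg.trans (htail 1 one_pos)) (Real.exp_pos _)
  have hlayer := lintegral_rpow_eq_lintegral_meas_le_mul ν hf_nonneg hf hn'
  simp only [Real.rpow_natCast] at hlayer
  have hle : ∫⁻ s in Set.Ioi 0, ν {z | s ≤ f z} * ENNReal.ofReal (s ^ ((n : ℝ) - 1)) ≤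
      ENNReal.ofReal B * ENNReal.ofReal ((1 / h) ^ (n : ℝ) * Real.Gamma n) := by
    rw [← lintegral_rpow_mul_exp_neg_mul_Ioi hn' hh,
      ← lintegral_const_mul' _ _ ENNReal.ofReal_ne_top]
    refine setLIntegral_mono' measurableSet_Ioi fun s (hs : 0 < s) => ?_
    rw [← ofReal_measureReal, ← ENNReal.ofReal_mul measureReal_nonneg, ← ENNReal.ofReal_mul hB,
      mul_left_comm, mul_comm (ν.real _)]
    gcongr
    exact htail s hs
  have hGamma : n * Real.Gamma n = n.factorial := by
    rw [← Real.Gamma_add_one hn'.ne', Real.Gamma_nat_eq_factorial]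
  rw [integral_eq_lintegral_of_nonneg_ae (hf_nonneg.mono fun z hz => pow_nonneg hz n)
    (hf.pow_const n).aestronglyMeasurable, hlayer]
  refine ENNReal.toReal_le_of_le_ofReal (by positivity) ((mul_le_mul_right hle _).trans_eq ?_)
  rw [← ENNReal.ofReal_mul hB, ← ENNReal.ofReal_mul hn'.le, Real.rpow_natCast, ← hGamma]
  congr 1
  ring

/-- The threshold `x - 3 / hazard x` minimizes the Markov bound `gaussCube 1 (-t) / (x - t) ^ 3`
when the normal tail is replaced by its log-tangent at `x`. -/
lemma gaussCube_le_mul_normalTail (x : ℝ) : gaussCube 1 (-(x - 3 / hazard x)) ≤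
    2 * Real.exp 3 / 9 * normalTail x * (3 / hazard x) ^ 3 := by
  have hh := hazard_pos x
  set t := x - 3 / hazard x
  have htail : ∀ s > 0, (gaussianReal 0 1).real {z | s ≤ max (-t + z) 0} ≤
      normalTail x * Real.exp 3 * Real.exp (-(hazard x * s)) := by
    intro s hs
    have hset : {z : ℝ | s ≤ max (-t + z) 0} = {z | t + s ≤ z} := by
      ext z
      simp only [Set.mem_ofPred_eq, le_max_iff, hs.not_ge, or_false, neg_add_eq_sub,
        le_sub_iff_add_le']
    rw [hset]
    refine (normalTail_le_mul_exp_hazard x (t + s)).trans_eq ?_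
    rw [mul_assoc, ← Real.exp_add]
    congr 2
    simp only [t]
    field_simp
    ring
  have h := integral_pow_le_of_measureReal_le_exp (by fun_prop)
    (ae_of_all _ fun _ => le_max_right _ _) hh htail three_pos
  refine h.trans_eq ?_
  norm_num [Nat.factorial]
  ring

end ExponentialTail

section TailComparison

local notation "φ" => gaussianPDFReal 0 1

lemma hasDerivAt_sum_range_pow_div_factorial (n : ℕ) (y : ℝ) :
    HasDerivAt (fun u : ℝ => ∑ k ∈ Finset.range (n + 1), u ^ k / k.factorial)
      (∑ k ∈ Finset.range n, y ^ k / k.factorial) y := by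
  simp only [Finset.sum_range_succ' _ n, pow_zero]
  refine (HasDerivAt.fun_sum fun k _ => ?_).add_const _
  refine ((hasDerivAt_pow (k + 1) y).div_const _).congr_deriv ?_
  rw [Nat.factorial_succ, Nat.cast_mul, Nat.add_sub_cancel, mul_div_mul_left _ _ (by positivity)]

lemma exp_neg_sub_sum_range_alternating (n : ℕ) {y : ℝ} (hy : 0 ≤ y) :
    0 ≤ (-1) ^ n * (Real.exp (-y) - ∑ k ∈ Finset.range n, (-y) ^ k / k.factorial) := by
  induction n generalizing y with
  | zero => simpa using (Real.exp_pos (-y)).le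
  | succ n ih =>
    have hderiv : ∀ u ∈ Set.Ici (0 : ℝ), HasDerivAt
        (fun u => (-1) ^ (n + 1) *
          (Real.exp (-u) - ∑ k ∈ Finset.range (n + 1), (-u) ^ k / k.factorial))
        ((-1) ^ n * (Real.exp (-u) - ∑ k ∈ Finset.range n, (-u) ^ k / k.factorial)) u := fun u _ =>
      (((hasDerivAt_neg u).exp.sub ((hasDerivAt_sum_range_pow_div_factorial n (-u)).comp u
        (hasDerivAt_neg u))).const_mul _).congr_deriv (by ring)
    have := monotoneOn_of_hasDerivAt_nonneg (convex_Ici 0) hderiv (fun u hu => ih hu)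
      Set.self_mem_Ici hy hy
    simpa [Finset.sum_range_succ'] using this

lemma normalTail_le_polynomial {a : ℝ} (ha : 0 ≤ a) :
    normalTail a ≤
      1 / 2 - (√(2 * Real.pi))⁻¹ * (a - a ^ 3 / 6 + a ^ 5 / 40 - a ^ 7 / 336) := by
  have hderiv : ∀ u ∈ Set.Ici (0 : ℝ), HasDerivAt (fun u =>
      1 / 2 - (√(2 * Real.pi))⁻¹ * (u - u ^ 3 / 6 + u ^ 5 / 40 - u ^ 7 / 336) - normalTail u)
      (φ u - (√(2 * Real.pi))⁻¹ * (1 - u ^ 2 / 2 + u ^ 4 / 8 - u ^ 6 / 48)) u := fun u _ =>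
    (((((((hasDerivAt_id u).sub ((hasDerivAt_pow 3 u).div_const 6)).add
      ((hasDerivAt_pow 5 u).div_const 40)).sub ((hasDerivAt_pow 7 u).div_const 336)).const_mul
      (√(2 * Real.pi))⁻¹).const_sub (1 / 2)).sub (hasDerivAt_normalTail u)).congr_deriv
      (by push_cast; ring)
  have hmono := monotoneOn_of_hasDerivAt_nonneg (convex_Ici 0) hderiv fun u _ => by
    have hexp := exp_neg_sub_sum_range_alternating 4 (by positivity : 0 ≤ u ^ 2 / 2)
    norm_num [Finset.sum_range_succ, Nat.factorial] at hexp
    simp only [stdGaussianPDFReal_eq, neg_div]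
    rw [← mul_sub]
    exact mul_nonneg (by positivity) (by linarith)
  have := hmono Set.self_mem_Ici ha ha
  norm_num [normalTail_zero] at this ⊢
  linarith

lemma exp_lam : Real.exp lam = 2 * Real.exp 3 / 9 := Real.exp_log (by positivity)

lemma sq_le_lam : (1.22 : ℝ) ^ 2 ≤ lam := by
  have hsplit : Real.exp 3 = Real.exp (1.22 ^ 2) * (Real.exp 1 * Real.exp 0.5116) := by
    rw [← Real.exp_add, ← Real.exp_add]
    norm_num
  have hexp : (1.667 : ℝ) ≤ Real.exp 0.5116 := by
    refine le_trans ?_ (Real.sum_le_exp_of_nonneg (by norm_num) 5)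
    norm_num [Finset.sum_range_succ, Nat.factorial]
  have hprod : (4.5 : ℝ) ≤ Real.exp 1 * Real.exp 0.5116 := by nlinarith [Real.exp_one_gt_d9]
  rw [← Real.exp_le_exp, exp_lam, hsplit]
  nlinarith [Real.exp_pos (1.22 ^ 2)]

lemma lam_pos : 0 < lam := lt_of_lt_of_le (by norm_num) sq_le_lam

lemma exp_lam_mul_normalTail_sqrt_lam_le : Real.exp lam * normalTail √lam ≤ 1 / 2 := by
  have hsqrt : √(2 * Real.pi) ≤ 2.50663 := by
    rw [Real.sqrt_le_left (by norm_num)]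
    linarith [Real.pi_lt_d6]
  have hinv : (2.50663 : ℝ)⁻¹ ≤ (√(2 * Real.pi))⁻¹ := inv_anti₀ (by positivity) hsqrt
  have htail : normalTail √lam ≤ 0.11185 := by
    refine (strictAnti_normalTail.antitone (Real.le_sqrt_of_sq_le sq_le_lam)).trans
      ((normalTail_le_polynomial (by norm_num)).trans ?_)
    norm_num at hinv ⊢
    linarith
  have hexp : Real.exp 3 ≤ 20.0856 := by
    calc Real.exp 3 = Real.exp 1 ^ 3 := by rw [← Real.exp_nat_mul]; norm_num
      _ ≤ 2.7182818286 ^ 3 := by gcongr; exact Real.exp_one_lt_d9.le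
      _ ≤ 20.0856 := by norm_num
  rw [exp_lam]
  nlinarith [normalTail_pos √lam, Real.exp_pos 3]

lemma antitoneOn_log_one_add_div :
    AntitoneOn (fun w : ℝ => Real.log (1 + w) / w) (Set.Ioi 0) := by
  intro w (hw : 0 < w) w' (hw' : 0 < w') hww'
  have := strictConcaveOn_log_Ioi.concaveOn.antitoneOn_slope_gt (Set.mem_Ioi.2 one_pos)
    (a := 1 + w) ⟨Set.mem_Ioi.2 (by positivity), by linarith⟩
    (b := 1 + w') ⟨Set.mem_Ioi.2 (by positivity), by linarith⟩ (by gcongr)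
  simpa [slope_def_field] using this

lemma hasDerivAt_normalTail_sub_div {l x : ℝ} (hl : 0 ≤ l) (hx : x ≠ 0) :
    HasDerivAt (fun x => normalTail (x - l / x) - Real.exp l * normalTail x)
      (Real.exp l * φ x * (1 - Real.exp (Real.log (1 + l / x ^ 2) - l / x ^ 2 * (l / 2)))) x := by
  have hshift : HasDerivAt (fun x : ℝ => x - l / x) (1 + l / x ^ 2) x :=
    ((hasDerivAt_id x).sub ((hasDerivAt_inv hx).const_mul l)).congr_deriv (by field_simp; ring)
  refine (((hasDerivAt_normalTail _).comp x hshift).sub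
    ((hasDerivAt_normalTail x).const_mul _)).congr_deriv ?_
  have hpdf : φ (x - l / x) = Real.exp l * φ x * Real.exp (-(l / x ^ 2 * (l / 2))) := by
    simp only [stdGaussianPDFReal_eq]
    rw [mul_left_comm, mul_assoc, ← Real.exp_add, ← Real.exp_add]
    congr 2
    field_simp
    ring
  rw [sub_eq_add_neg (Real.log _), Real.exp_add, Real.exp_log (by positivity), hpdf]
  ring

lemma antitoneOn_normalTail_sub_div {l x : ℝ} (hl : 0 < l) (hx : 0 < x)
    (h : l / 2 ≤ Real.log (1 + l / x ^ 2) / (l / x ^ 2)) :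
    AntitoneOn (fun x => normalTail (x - l / x) - Real.exp l * normalTail x) (Set.Ici x) := by
  refine antitoneOn_of_hasDerivAt_nonpos (convex_Ici x)
    (fun u (hu : x ≤ u) => hasDerivAt_normalTail_sub_div hl.le (hx.trans_le hu).ne')
    fun u (hu : x ≤ u) => ?_
  have hu0 : 0 < u := hx.trans_le hu
  have hw : 0 < l / u ^ 2 := by positivity
  have hu' := h.trans (antitoneOn_log_one_add_div hw (by positivity : 0 < l / x ^ 2) (by gcongr))
  rw [le_div_iff₀' hw] at hu'
  exact mul_nonpos_of_nonneg_of_nonpos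
    (mul_pos (Real.exp_pos _) (stdGaussianPDFReal_pos u)).le
    (sub_nonpos.2 (Real.one_le_exp (sub_nonneg.2 hu')))

lemma monotoneOn_normalTail_sub_div {l x : ℝ} (hl : 0 < l)
    (h : Real.log (1 + l / x ^ 2) / (l / x ^ 2) ≤ l / 2) :
    MonotoneOn (fun x => normalTail (x - l / x) - Real.exp l * normalTail x) (Set.Ioc 0 x) := by
  refine monotoneOn_of_hasDerivAt_nonneg (convex_Ioc 0 x)
    (fun u hu => hasDerivAt_normalTail_sub_div hl.le hu.1.ne') fun u hu => ?_
  have hu0 : 0 < u := hu.1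
  have hx : 0 < x := hu0.trans_le hu.2
  have hw : 0 < l / u ^ 2 := by positivity
  have hu' := (antitoneOn_log_one_add_div (by positivity : 0 < l / x ^ 2) hw
    (by have := hu.2; gcongr)).trans h
  rw [div_le_iff₀' hw] at hu'
  exact mul_nonneg (mul_pos (Real.exp_pos _) (stdGaussianPDFReal_pos u)).le
    (sub_nonneg.2 (Real.exp_le_one_iff.2 (sub_nonpos.2 hu')))

lemma tendsto_normalTail_sub_div (l : ℝ) :
    Tendsto (fun x => normalTail (x - l / x) - Real.exp l * normalTail x) atTop (𝓝 0) := by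
  have hshift : Tendsto (fun x : ℝ => x - l / x) atTop atTop := by
    simpa only [sub_eq_add_neg, id] using
      tendsto_id.atTop_add (tendsto_const_nhds.div_atTop tendsto_id : Tendsto (l / ·) _ _).neg
  simpa using (tendsto_normalTail_atTop.comp hshift).sub
    (tendsto_normalTail_atTop.const_mul (Real.exp l))

/-- The difference of the two sides has limit `0` at infinity, and its derivative changes sign at
most once, from positive to negative, so that only the endpoint `√l` needs to be checked. -/
lemma exp_mul_normalTail_le_normalTail_sub_div {l x : ℝ} (hl : 0 < l)
    (hsqrt : Real.exp l * normalTail √l ≤ 1 / 2) (hx : √l ≤ x) :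
    Real.exp l * normalTail x ≤ normalTail (x - l / x) := by
  have hl' : 0 < √l := Real.sqrt_pos.2 hl
  have hx0 : 0 < x := hl'.trans_le hx
  rw [← sub_nonneg]
  rcases le_total (l / 2) (Real.log (1 + l / x ^ 2) / (l / x ^ 2)) with h | h
  · exact le_of_antitoneOn_Ici_of_tendsto
      (f := fun x => normalTail (x - l / x) - Real.exp l * normalTail x)
      (antitoneOn_normalTail_sub_div hl hx0 h) (tendsto_normalTail_sub_div l)
  · refine le_trans ?_ (monotoneOn_normalTail_sub_div hl h ⟨hl', hx⟩ ⟨hx0, le_rfl⟩ hx)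
    simpa [Real.div_sqrt, normalTail_zero] using hsqrt

lemma inv_one_add_sq_le_normalTail_sub_div {l x : ℝ} (hl : 5 / 4 ≤ l) (hx : 0 < x)
    (hxl : x ^ 2 ≤ l) : 1 / (1 + x ^ 2) ≤ normalTail (x - l / x) := by
  obtain ⟨y, hy_eq⟩ : ∃ y, y = l / x - x := ⟨_, rfl⟩
  have hxy : x * y = l - x ^ 2 := by rw [hy_eq]; field_simp
  have hy : 0 ≤ y := nonneg_of_mul_nonneg_right (by linarith) hx
  have hexp : Real.exp (-y ^ 2 / 2) ≤ 1 / (1 + y ^ 2 / 2) := by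
    rw [neg_div, Real.exp_neg, one_div]
    exact inv_anti₀ (by positivity) (by linarith [Real.add_one_le_exp (y ^ 2 / 2)])
  have hrational : 1 / (1 + y ^ 2 / 2) / 2 ≤ 1 - 1 / (1 + x ^ 2) := by
    have hright : 1 - 1 / (1 + x ^ 2) = x ^ 2 / (1 + x ^ 2) := by field_simp; ring
    have hleft : 1 / (1 + y ^ 2 / 2) / 2 = 1 / (2 + y ^ 2) := by field_simp
    have hxy_sq : x ^ 2 * y ^ 2 = (l - x ^ 2) ^ 2 := by rw [← hxy]; ring
    rw [hright, hleft, div_le_div_iff₀ (by positivity) (by positivity)]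
    nlinarith [sq_nonneg (l - x ^ 2 - 1 / 2)]
  rw [show x - l / x = -y by rw [hy_eq]; ring, normalTail_neg]
  linarith [normalTail_le_exp_div_two hy]

end TailComparison

section MartingaleDifferences

/-- A sequence of martingale differences with values in `[-1, 1]` almost surely; `ξ i` is the
increment from time `i` to time `i + 1`. -/
structure IsUnitMartingaleDiff {Ω : Type*} {mΩ : MeasurableSpace Ω} (μ : Measure Ω)
    (𝒢 : Filtration ℕ mΩ) (ξ : ℕ → Ω → ℝ) : Prop where
  stronglyMeasurable : ∀ i, StronglyMeasurable[𝒢 (i + 1)] (ξ i)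
  condExp_eq_zero : ∀ i, μ[ξ i | 𝒢 i] =ᵐ[μ] 0
  abs_le_one : ∀ i, ∀ᵐ ω ∂μ, |ξ i ω| ≤ 1

/-- The sum of the first `n` of the vectors `x i` with random coefficients `ξ i`. -/
def partialSum {Ω E : Type*} [AddCommMonoid E] [Module ℝ E] (ξ : ℕ → Ω → ℝ) (x : ℕ → E) (n : ℕ)
    (ω : Ω) : E :=
  ∑ i ∈ Finset.range n, ξ i ω • x i

lemma partialSum_succ {Ω E : Type*} [AddCommMonoid E] [Module ℝ E] (ξ : ℕ → Ω → ℝ) (x : ℕ → E)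
    (n : ℕ) (ω : Ω) : partialSum ξ x (n + 1) ω = partialSum ξ x n ω + ξ n ω • x n :=
  Finset.sum_range_succ _ n

namespace IsUnitMartingaleDiff

variable {Ω : Type*} {mΩ : MeasurableSpace Ω} {μ : Measure Ω} {𝒢 : Filtration ℕ mΩ}
  {ξ : ℕ → Ω → ℝ}

lemma shift (h : IsUnitMartingaleDiff μ 𝒢 ξ) (m : ℕ) :
    IsUnitMartingaleDiff μ
      (⟨fun n => 𝒢 (m + n), fun _ _ hij => 𝒢.mono (by gcongr), fun n => 𝒢.le _⟩ : Filtration ℕ mΩ)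
      fun i => ξ (m + i) :=
  ⟨fun i => h.stronglyMeasurable (m + i), fun i => h.condExp_eq_zero (m + i),
    fun i => h.abs_le_one (m + i)⟩

lemma integrable [IsFiniteMeasure μ] (h : IsUnitMartingaleDiff μ 𝒢 ξ) (i : ℕ) :
    Integrable (ξ i) μ :=
  .of_bound ((h.stronglyMeasurable i).mono (𝒢.le _)).aestronglyMeasurable 1 (h.abs_le_one i)

section TopologicalVectorSpace

variable {E : Type*} [TopologicalSpace E] [AddCommMonoid E] [ContinuousAdd E] [Module ℝ E]
  [ContinuousSMul ℝ E] (x : ℕ → E)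

lemma stronglyMeasurable_partialSum (h : IsUnitMartingaleDiff μ 𝒢 ξ) (n : ℕ) :
    StronglyMeasurable[𝒢 n] (partialSum ξ x n) :=
  Finset.stronglyMeasurable_fun_sum _ fun i hi =>
    ((h.stronglyMeasurable i).mono (𝒢.mono (Finset.mem_range.1 hi))).smul_const (x i)

lemma aestronglyMeasurable_partialSum (h : IsUnitMartingaleDiff μ 𝒢 ξ) (n : ℕ) :
    AEStronglyMeasurable (partialSum ξ x n) μ :=
  ((h.stronglyMeasurable_partialSum x n).mono (𝒢.le n)).aestronglyMeasurable

open scoped Pointwise in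
lemma exists_isCompact_partialSum_mem (h : IsUnitMartingaleDiff μ 𝒢 ξ) (n : ℕ) :
    ∃ K : Set E, IsCompact K ∧ ∀ᵐ ω ∂μ, partialSum ξ x n ω ∈ K := by
  induction n with
  | zero => exact ⟨{0}, isCompact_singleton, ae_of_all _ fun _ => rfl⟩
  | succ n ih =>
    obtain ⟨K, hK, hSK⟩ := ih
    refine ⟨K + (fun s : ℝ => s • x n) '' Set.Icc (-1) 1,
      hK.add (isCompact_Icc.image (by fun_prop)), ?_⟩
    filter_upwards [hSK, h.abs_le_one n] with ω hS hξ
    rw [partialSum_succ]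
    exact Set.add_mem_add hS (Set.mem_image_of_mem _ (abs_le.1 hξ))

lemma exists_ae_norm_comp_partialSum_le (h : IsUnitMartingaleDiff μ 𝒢 ξ) (n : ℕ) {G : E → ℝ}
    (hG : Continuous G) : ∃ C : ℝ, ∀ᵐ ω ∂μ, ‖G (partialSum ξ x n ω)‖ ≤ C := by
  obtain ⟨K, hK, hSK⟩ := h.exists_isCompact_partialSum_mem x n
  obtain ⟨C, hC⟩ := hK.exists_bound_of_continuousOn hG.continuousOn
  exact ⟨C, hSK.mono fun ω hω => hC _ hω⟩

variable [IsFiniteMeasure μ]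

lemma integrable_comp_partialSum (h : IsUnitMartingaleDiff μ 𝒢 ξ) (n : ℕ) {G : E → ℝ}
    (hG : Continuous G) : Integrable (fun ω => G (partialSum ξ x n ω)) μ := by
  obtain ⟨C, hC⟩ := h.exists_ae_norm_comp_partialSum_le x n hG
  exact .of_bound (hG.comp_aestronglyMeasurable (h.aestronglyMeasurable_partialSum x n)) C hC

lemma integrable_comp_partialSum_mul (h : IsUnitMartingaleDiff μ 𝒢 ξ) (n : ℕ) {G : E → ℝ}
    (hG : Continuous G) : Integrable (fun ω => G (partialSum ξ x n ω) * ξ n ω) μ := by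
  obtain ⟨C, hC⟩ := h.exists_ae_norm_comp_partialSum_le x n hG
  exact (h.integrable n).bdd_mul
    (hG.comp_aestronglyMeasurable (h.aestronglyMeasurable_partialSum x n)) hC

lemma condExp_comp_partialSum_mul (h : IsUnitMartingaleDiff μ 𝒢 ξ) (n : ℕ) {G : E → ℝ}
    (hG : Continuous G) : μ[fun ω => G (partialSum ξ x n ω) * ξ n ω | 𝒢 n] =ᵐ[μ] 0 := by
  obtain ⟨C, hC⟩ := h.exists_ae_norm_comp_partialSum_le x n hG
  have hpull := condExp_stronglyMeasurable_mul_of_bound (𝒢.le n)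
    (hG.comp_stronglyMeasurable (h.stronglyMeasurable_partialSum x n)) (h.integrable n) C hC
  filter_upwards [hpull, h.condExp_eq_zero n] with ω hpull hzero
  exact hpull.trans (by rw [Pi.mul_apply, hzero, Pi.zero_apply, mul_zero])

lemma integral_comp_partialSum_mul (h : IsUnitMartingaleDiff μ 𝒢 ξ) (n : ℕ) {G : E → ℝ}
    (hG : Continuous G) : ∫ ω, G (partialSum ξ x n ω) * ξ n ω ∂μ = 0 := by
  rw [← integral_condExp (𝒢.le n), integral_congr_ae (h.condExp_comp_partialSum_mul x n hG)]
  exact integral_zero _ _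

end TopologicalVectorSpace

end IsUnitMartingaleDiff

end MartingaleDifferences

section VariancePotential

lemma add_smul_le_of_convexOn {E : Type*} [AddCommGroup E] [Module ℝ E] {G : E → ℝ}
    (hG : ConvexOn ℝ Set.univ G) (a x : E) {s : ℝ} (hs : |s| ≤ 1) :
    G (a + s • x) ≤ (G (a + x) + G (a - x)) / 2 + (G (a + x) - G (a - x)) / 2 * s := by
  obtain ⟨hs_ge, hs_le⟩ := abs_le.1 hs
  have hconv := hG.2 (Set.mem_univ (a + x)) (Set.mem_univ (a - x))
    (by linarith : 0 ≤ (1 + s) / 2) (by linarith : 0 ≤ (1 - s) / 2) (by ring)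
  rw [show ((1 + s) / 2) • (a + x) + ((1 - s) / 2) • (a - x) = a + s • x by module] at hconv
  simp only [smul_eq_mul] at hconv
  linarith

/-- A family `Φ R` of convex functions for which averaging over a symmetric two-point step `±x` is
dominated by increasing the variance parameter `R` by `‖x‖ ^ 2`. Every tail bound below comes from
Markov's inequality for such a family. -/
structure IsVariancePotential {E : Type*} [NormedAddCommGroup E] [NormedSpace ℝ E]
    (Φ : ℝ≥0 → E → ℝ) : Prop where
  convexOn : ∀ R, ConvexOn ℝ Set.univ (Φ R)
  continuous : ∀ R, Continuous (Φ R)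
  add_add_sub_le : ∀ R a x, Φ R (a + x) + Φ R (a - x) ≤ 2 * Φ (R + ‖x‖₊ ^ 2) a

variable {Ω : Type*} {mΩ : MeasurableSpace Ω} {μ : Measure Ω} [IsProbabilityMeasure μ]
  {𝒢 : Filtration ℕ mΩ} {ξ : ℕ → Ω → ℝ} {E : Type*} [NormedAddCommGroup E]

section NormedSpace

variable [NormedSpace ℝ E] {Φ : ℝ≥0 → E → ℝ} {x : ℕ → E}

lemma IsVariancePotential.integral_partialSum_le (hΦ : IsVariancePotential Φ)
    (h : IsUnitMartingaleDiff μ 𝒢 ξ) {R : ℝ≥0} {n : ℕ}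
    (hx : ∑ i ∈ Finset.range n, ‖x i‖₊ ^ 2 ≤ R) :
    ∫ ω, Φ (R - ∑ i ∈ Finset.range n, ‖x i‖₊ ^ 2) (partialSum ξ x n ω) ∂μ ≤ Φ R 0 := by
  induction n with
  | zero => simp [partialSum]
  | succ n ih =>
    rw [Finset.sum_range_succ] at hx ⊢
    set r := R - (∑ i ∈ Finset.range n, ‖x i‖₊ ^ 2 + ‖x n‖₊ ^ 2) with hr
    have hr_add : R - ∑ i ∈ Finset.range n, ‖x i‖₊ ^ 2 = r + ‖x n‖₊ ^ 2 := by
      rw [hr, ← tsub_tsub, tsub_add_cancel_of_le (le_tsub_of_add_le_left hx)]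
    have hcont := hΦ.continuous
    set W : E → ℝ := fun a => (Φ r (a + x n) - Φ r (a - x n)) / 2
    have hW : Continuous W := by fun_prop
    have hS := h.integrable_comp_partialSum x n (hcont (r + ‖x n‖₊ ^ 2))
    have hWξ := h.integrable_comp_partialSum_mul x n hW
    refine le_trans ?_ (ih (le_self_add.trans hx))
    rw [hr_add, ← add_zero (∫ ω, Φ (r + _) _ ∂μ), ← h.integral_comp_partialSum_mul x n hW,
      ← integral_add hS hWξ]
    refine integral_mono_ae (h.integrable_comp_partialSum x (n + 1) (hcont r)) (hS.add hWξ) ?_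
    filter_upwards [h.abs_le_one n] with ω hω
    have hchord := add_smul_le_of_convexOn (hΦ.convexOn r) (partialSum ξ x n ω) (x n) hω
    have hstep := hΦ.add_add_sub_le r (partialSum ξ x n ω) (x n)
    simp only [partialSum_succ, W]
    linarith

lemma IsVariancePotential.measureReal_partialSum_mem_le (hΦ : IsVariancePotential Φ)
    (hΦ_nonneg : ∀ R a, 0 ≤ Φ R a) (h : IsUnitMartingaleDiff μ 𝒢 ξ) {R : ℝ≥0} {n : ℕ}
    (hx : ∑ i ∈ Finset.range n, ‖x i‖₊ ^ 2 ≤ R) {s : Set E} {ε : ℝ} (hε : 0 < ε)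
    (hs : ∀ r, ∀ a ∈ s, ε ≤ Φ r a) : μ.real {ω | partialSum ξ x n ω ∈ s} ≤ Φ R 0 / ε := by
  set r := R - ∑ i ∈ Finset.range n, ‖x i‖₊ ^ 2
  rw [le_div_iff₀' hε]
  calc ε * μ.real {ω | partialSum ξ x n ω ∈ s}
      ≤ ε * μ.real {ω | ε ≤ Φ r (partialSum ξ x n ω)} :=
        mul_le_mul_of_nonneg_left (measureReal_mono fun _ => hs r _) hε.le
    _ ≤ ∫ ω, Φ r (partialSum ξ x n ω) ∂μ := mul_meas_ge_le_integral_of_nonneg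
        (ae_of_all _ fun _ => hΦ_nonneg _ _) (h.integrable_comp_partialSum x n (hΦ.continuous r)) ε
    _ ≤ Φ R 0 := hΦ.integral_partialSum_le h hx

end NormedSpace

lemma isVariancePotential_gaussCube (t : ℝ) :
    IsVariancePotential fun R (a : ℝ) => gaussCube R (a - t) where
  convexOn R := by
    simpa only [Function.comp_def, Set.preimage_univ, ← sub_eq_add_neg] using
      (convexOn_gaussCube R).translate_left (-t)
  continuous R := by fun_prop
  add_add_sub_le R a x := by
    simpa only [add_sub_right_comm, sub_right_comm a] using
      gaussCube_add_gaussCube_sub_le R x (a - t)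

lemma isVariancePotential_exp (s : ℝ) :
    IsVariancePotential fun R (a : ℝ) => Real.exp (s * a + s ^ 2 * R / 2) where
  convexOn R := by
    have hexp : ConvexOn ℝ Set.univ fun a : ℝ => Real.exp (s * a) :=
      convexOn_exp.comp_linearMap (LinearMap.mul ℝ ℝ s)
    simpa only [smul_eq_mul, ← Real.exp_add, add_comm] using
      hexp.smul (Real.exp_pos (s ^ 2 * R / 2)).le
  continuous R := by fun_prop
  add_add_sub_le R a x := by
    have hcosh := mul_le_mul_of_nonneg_left (Real.cosh_le_exp_half_sq (s * x))
      (Real.exp_pos (s * a + s ^ 2 * R / 2)).le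
    rw [Real.cosh_eq, ← mul_div_assoc, mul_add] at hcosh
    simp only [← Real.exp_add] at hcosh
    rw [NNReal.coe_add, NNReal.coe_pow, coe_nnnorm, Real.norm_eq_abs, sq_abs]
    ring_nf at hcosh ⊢
    linarith

variable [InnerProductSpace ℝ E]

lemma isVariancePotential_radialCube (q : ℝ) :
    IsVariancePotential (E := E) (radialCube q) where
  convexOn R := convexOn_radialCube q R
  continuous R := continuous_radialCube q R
  add_add_sub_le R a x := radialCube_add_radialCube_sub_le q R a x

lemma isVariancePotential_norm_add_sq (b : E) :
    IsVariancePotential fun R a => ‖a + b‖ ^ 2 + R where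
  convexOn R := by
    have hsq := (convexOn_univ_norm (E := E)).pow (fun _ _ => norm_nonneg _) 2
    exact (hsq.translate_left b).add_const _
  continuous R := by fun_prop
  add_add_sub_le R a x := by
    have hlaw := parallelogram_law_with_norm ℝ (a + b) x
    rw [NNReal.coe_add, NNReal.coe_pow, coe_nnnorm, add_right_comm a,
      ← add_sub_right_comm a]
    linarith

end VariancePotential

section TailBounds

lemma le_twoSidedBound {p x : ℝ} (hx : 0 < x) (hone : p ≤ 1) (hsq : p ≤ 1 / x ^ 2)
    (htail : p ≤ 2 * (Real.exp lam * normalTail x)) : p ≤ twoSidedBound x := by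
  refine le_min hsq ?_
  rw [normalTwoTail_eq]
  rcases le_total √lam x with h | h
  · have hnonneg : 0 ≤ x - lam / x := by
      rw [sub_nonneg, div_le_iff₀ hx, ← sq]
      exact (Real.sqrt_le_left hx.le).1 h
    rw [max_eq_left hnonneg]
    linarith [exp_mul_normalTail_le_normalTail_sub_div lam_pos exp_lam_mul_normalTail_sqrt_lam_le h]
  · have hnonpos : x - lam / x ≤ 0 := by
      rw [sub_nonpos, le_div_iff₀ hx, ← sq]
      exact (Real.le_sqrt hx.le lam_pos.le).1 h
    rwa [max_eq_right hnonpos, normalTail_zero, mul_one_div_cancel two_ne_zero]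

lemma le_oneSidedBound {p x : ℝ} (hx : 0 < x) (hcantelli : p ≤ 1 / (1 + x ^ 2))
    (hexp : p ≤ Real.exp (-x ^ 2 / 2)) (htail : p ≤ Real.exp lam * normalTail x) :
    p ≤ oneSidedBound x := by
  refine le_min hexp ?_
  rcases le_total √lam x with h | h
  · exact htail.trans
      (exp_mul_normalTail_le_normalTail_sub_div lam_pos exp_lam_mul_normalTail_sqrt_lam_le h)
  · exact hcantelli.trans (inv_one_add_sq_le_normalTail_sub_div
      (le_trans (by norm_num) sq_le_lam) hx ((Real.le_sqrt hx.le lam_pos.le).1 h))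

lemma continuousAt_twoSidedBound {x : ℝ} (hx : x ≠ 0) : ContinuousAt twoSidedBound x := by
  have hsq : ContinuousAt (fun y : ℝ => 1 / y ^ 2) x := by fun_prop (disch := positivity)
  have hshift : ContinuousAt (fun y : ℝ => y - lam / y) x := by fun_prop (disch := exact hx)
  exact hsq.min (continuous_normalTwoTail.continuousAt.comp hshift)

namespace IsUnitMartingaleDiff

variable {Ω : Type*} {mΩ : MeasurableSpace Ω} {μ : Measure Ω} [IsProbabilityMeasure μ]
  {𝒢 : Filtration ℕ mΩ} {ξ : ℕ → Ω → ℝ} {n : ℕ}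

section Hilbert

variable {E : Type*} [NormedAddCommGroup E] [InnerProductSpace ℝ E] {v : ℕ → E}

lemma measureReal_norm_partialSum_ge_le_inv_sq (h : IsUnitMartingaleDiff μ 𝒢 ξ)
    (hv : ∑ i ∈ Finset.range n, ‖v i‖₊ ^ 2 ≤ 1) {x : ℝ} (hx : 0 < x) :
    μ.real {ω | x ≤ ‖partialSum ξ v n ω‖} ≤ 1 / x ^ 2 := by
  have hmarkov := (isVariancePotential_norm_add_sq (0 : E)).measureReal_partialSum_mem_le
    (fun _ _ => by positivity) h hv (pow_pos hx 2) (s := {a | x ≤ ‖a‖})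
    fun r a (ha : x ≤ ‖a‖) => by
      rw [add_zero]
      exact (pow_le_pow_left₀ hx.le ha 2).trans (le_add_of_nonneg_right r.coe_nonneg)
  simpa using hmarkov

lemma measureReal_norm_partialSum_ge_le_normalTail (h : IsUnitMartingaleDiff μ 𝒢 ξ)
    (hv : ∑ i ∈ Finset.range n, ‖v i‖₊ ^ 2 ≤ 1) (x : ℝ) :
    μ.real {ω | x ≤ ‖partialSum ξ v n ω‖} ≤ 2 * (Real.exp lam * normalTail x) := by
  have hgap : 0 < (3 / hazard x) ^ 3 := pow_pos (div_pos three_pos (hazard_pos x)) 3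
  refine ((isVariancePotential_radialCube (-(x - 3 / hazard x))).measureReal_partialSum_mem_le
    (fun r a => add_nonneg (gaussCube_nonneg _ _) (gaussCube_nonneg _ _)) h hv hgap
    (s := {a | x ≤ ‖a‖}) fun r a (ha : x ≤ ‖a‖) => ?_).trans ?_
  · refine le_add_of_le_of_nonneg ?_ (gaussCube_nonneg _ _)
    exact pow_le_gaussCube r (div_pos three_pos (hazard_pos x)).le (by linarith)
  · rw [div_le_iff₀ hgap, exp_lam, radialCube, norm_zero, add_zero, sub_zero]
    linarith [gaussCube_le_mul_normalTail x]

theorem measureReal_norm_partialSum_ge_le_twoSidedBound (h : IsUnitMartingaleDiff μ 𝒢 ξ)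
    (hv : ∑ i ∈ Finset.range n, ‖v i‖₊ ^ 2 ≤ 1) {x : ℝ} (hx : 0 < x) :
    μ.real {ω | x ≤ ‖partialSum ξ v n ω‖} ≤ twoSidedBound x :=
  le_twoSidedBound hx measureReal_le_one (h.measureReal_norm_partialSum_ge_le_inv_sq hv hx)
    (h.measureReal_norm_partialSum_ge_le_normalTail hv x)

end Hilbert

variable {c : ℕ → ℝ}

lemma measureReal_partialSum_ge_le_normalTail (h : IsUnitMartingaleDiff μ 𝒢 ξ)
    (hc : ∑ i ∈ Finset.range n, ‖c i‖₊ ^ 2 ≤ 1) (x : ℝ) :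
    μ.real {ω | x ≤ partialSum ξ c n ω} ≤ Real.exp lam * normalTail x := by
  have hgap : 0 < (3 / hazard x) ^ 3 := pow_pos (div_pos three_pos (hazard_pos x)) 3
  refine ((isVariancePotential_gaussCube (x - 3 / hazard x)).measureReal_partialSum_mem_le
    (fun r a => gaussCube_nonneg _ _) h hc hgap (s := Set.Ici x)
    fun r a (ha : x ≤ a) => ?_).trans ?_
  · exact pow_le_gaussCube r (div_pos three_pos (hazard_pos x)).le (by linarith)
  · rw [div_le_iff₀ hgap, exp_lam, zero_sub]
    exact gaussCube_le_mul_normalTail x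

lemma measureReal_partialSum_ge_le_exp (h : IsUnitMartingaleDiff μ 𝒢 ξ)
    (hc : ∑ i ∈ Finset.range n, ‖c i‖₊ ^ 2 ≤ 1) {x : ℝ} (hx : 0 ≤ x) :
    μ.real {ω | x ≤ partialSum ξ c n ω} ≤ Real.exp (-x ^ 2 / 2) := by
  refine ((isVariancePotential_exp x).measureReal_partialSum_mem_le
    (fun r a => (Real.exp_pos _).le) h hc (Real.exp_pos (x * x)) (s := Set.Ici x)
    fun r a (ha : x ≤ a) => ?_).trans_eq ?_
  · exact Real.exp_le_exp.2 (le_add_of_le_of_nonneg (by gcongr) (by positivity))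
  · rw [← Real.exp_sub, NNReal.coe_one]
    ring_nf

/-- Translating by `1 / x` before squaring minimizes the Markov bound. -/
lemma measureReal_partialSum_ge_le_inv_one_add_sq (h : IsUnitMartingaleDiff μ 𝒢 ξ)
    (hc : ∑ i ∈ Finset.range n, ‖c i‖₊ ^ 2 ≤ 1) {x : ℝ} (hx : 0 < x) :
    μ.real {ω | x ≤ partialSum ξ c n ω} ≤ 1 / (1 + x ^ 2) := by
  refine ((isVariancePotential_norm_add_sq (1 / x)).measureReal_partialSum_mem_le
    (fun _ _ => by positivity) h hc (by positivity : 0 < (x + 1 / x) ^ 2) (s := Set.Ici x)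
    fun r a (ha : x ≤ a) => ?_).trans_eq ?_
  · refine le_add_of_le_of_nonneg ?_ r.coe_nonneg
    rw [Real.norm_eq_abs, sq_abs]
    gcongr
  · rw [zero_add, Real.norm_eq_abs, sq_abs, NNReal.coe_one]
    field_simp
    ring

theorem measureReal_partialSum_ge_le_oneSidedBound (h : IsUnitMartingaleDiff μ 𝒢 ξ)
    (hc : ∑ i ∈ Finset.range n, ‖c i‖₊ ^ 2 ≤ 1) {x : ℝ} (hx : 0 < x) :
    μ.real {ω | x ≤ partialSum ξ c n ω} ≤ oneSidedBound x :=
  le_oneSidedBound hx (h.measureReal_partialSum_ge_le_inv_one_add_sq hc hx)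
    (h.measureReal_partialSum_ge_le_exp hc hx.le) (h.measureReal_partialSum_ge_le_normalTail hc x)

end IsUnitMartingaleDiff

lemma measureReal_norm_ge_le_of_tendsto {Ω : Type*} {mΩ : MeasurableSpace Ω} {μ : Measure Ω}
    [IsFiniteMeasure μ] {E : Type*} [NormedAddCommGroup E] {U : ℕ → Ω → E} {T : Ω → E}
    (hU : ∀ n, AEStronglyMeasurable (U n) μ)
    (hT : ∀ᵐ ω ∂μ, Tendsto (fun n => U n ω) atTop (𝓝 (T ω))) {B : ℝ → ℝ} {x : ℝ}
    (hB : ContinuousAt B x) (h : ∀ᶠ y in 𝓝[<] x, ∀ n, μ.real {ω | y ≤ ‖U n ω‖} ≤ B y) :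
    μ.real {ω | x ≤ ‖T ω‖} ≤ B x := by
  refine ge_of_tendsto (hB.mono_left nhdsWithin_le_nhds : Tendsto B (𝓝[<] x) _) ?_
  filter_upwards [h, self_mem_nhdsWithin] with y hy (hyx : y < x)
  have hlim := tendstoInMeasure_iff_measureReal_norm.1 (tendstoInMeasure_of_tendsto_ae hU hT)
    (x - y) (sub_pos.2 hyx)
  refine ge_of_tendsto' (by simpa only [add_zero] using hlim.const_add (B y)) fun n => ?_
  have hsub : {ω | x ≤ ‖T ω‖} ⊆ {ω | y ≤ ‖U n ω‖} ∪ {ω | x - y ≤ ‖U n ω - T ω‖} := by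
    intro ω (hω : x ≤ ‖T ω‖)
    refine or_iff_not_imp_left.2 fun (hlt : ¬ y ≤ ‖U n ω‖) => (?_ : x - y ≤ ‖U n ω - T ω‖)
    have := norm_sub_norm_le (T ω) (U n ω)
    rw [norm_sub_rev] at this
    linarith
  exact (measureReal_mono hsub).trans
    ((measureReal_union_le _ _).trans (add_le_add_left (hy n) _))

end TailBounds

section AlmostSureConvergence

namespace IsUnitMartingaleDiff

variable {Ω : Type*} {mΩ : MeasurableSpace Ω} {μ : Measure Ω} {𝒢 : Filtration ℕ mΩ}
  {ξ : ℕ → Ω → ℝ} {E : Type*} [NormedAddCommGroup E] [InnerProductSpace ℝ E]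

lemma submartingale_norm_sq_partialSum [IsFiniteMeasure μ] (h : IsUnitMartingaleDiff μ 𝒢 ξ)
    (v : ℕ → E) : Submartingale (fun n ω => ‖partialSum ξ v n ω‖ ^ 2) 𝒢 μ := by
  have hint : ∀ n, Integrable (fun ω => ‖partialSum ξ v n ω‖ ^ 2) μ := fun n =>
    h.integrable_comp_partialSum v n (G := fun a => ‖a‖ ^ 2) (by fun_prop)
  have hmeas : ∀ n, StronglyMeasurable[𝒢 n] fun ω => ‖partialSum ξ v n ω‖ ^ 2 := fun n =>
    (h.stronglyMeasurable_partialSum v n).norm.pow 2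
  refine submartingale_nat hmeas hint fun n => ?_
  have hcont : Continuous fun a : E => 2 * inner ℝ a (v n) := by fun_prop
  have hcross := h.integrable_comp_partialSum_mul v n hcont
  have hexpand : (fun ω => ‖partialSum ξ v n ω‖ ^ 2) +
      (fun ω => 2 * inner ℝ (partialSum ξ v n ω) (v n) * ξ n ω) ≤ᵐ[μ]
      fun ω => ‖partialSum ξ v (n + 1) ω‖ ^ 2 := ae_of_all _ fun ω => by
    simp only [Pi.add_apply, partialSum_succ, norm_add_sq_real, real_inner_smul_right]
    linarith [sq_nonneg ‖ξ n ω • v n‖]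
  filter_upwards [condExp_mono (m := 𝒢 n) ((hint n).add hcross) (hint (n + 1)) hexpand,
    condExp_add (hint n) hcross (𝒢 n), h.condExp_comp_partialSum_mul v n hcont]
    with ω hmono hadd hzero
  refine Eq.trans_le ?_ hmono
  rw [hadd, Pi.add_apply, hzero, condExp_of_stronglyMeasurable (𝒢.le n) (hmeas n) (hint n),
    Pi.zero_apply, add_zero]

variable [IsProbabilityMeasure μ] {v : ℕ → E}

lemma integral_norm_sq_partialSum_le (h : IsUnitMartingaleDiff μ 𝒢 ξ) {r : ℝ≥0} {n : ℕ}
    (hv : ∑ i ∈ Finset.range n, ‖v i‖₊ ^ 2 ≤ r) : ∫ ω, ‖partialSum ξ v n ω‖ ^ 2 ∂μ ≤ r := by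
  have hpot := (isVariancePotential_norm_add_sq (0 : E)).integral_partialSum_le h hv
  rw [integral_add (h.integrable_comp_partialSum v n (G := fun a => ‖a + 0‖ ^ 2) (by fun_prop))
    (integrable_const _), integral_const, probReal_univ, one_smul] at hpot
  simp only [add_zero, norm_zero, zero_pow two_ne_zero, zero_add] at hpot
  exact (le_add_of_nonneg_right (NNReal.coe_nonneg _)).trans hpot

lemma mul_measure_exists_norm_sq_partialSum_ge_le (h : IsUnitMartingaleDiff μ 𝒢 ξ) {r : ℝ≥0}
    (hv : ∀ n, ∑ i ∈ Finset.range n, ‖v i‖₊ ^ 2 ≤ r) (ε : ℝ≥0) :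
    ε * μ {ω | ∃ k, (ε : ℝ) ≤ ‖partialSum ξ v k ω‖ ^ 2} ≤ r := by
  set A : ℕ → Set Ω := fun n => {ω | ∃ k ≤ n, (ε : ℝ) ≤ ‖partialSum ξ v k ω‖ ^ 2}
  have hunion : {ω | ∃ k, (ε : ℝ) ≤ ‖partialSum ξ v k ω‖ ^ 2} = ⋃ n, A n := by
    ext ω
    simp only [A, Set.mem_iUnion, Set.mem_ofPred_eq]
    exact ⟨fun ⟨k, hk⟩ => ⟨k, k, le_rfl, hk⟩, fun ⟨_, k, _, hk⟩ => ⟨k, hk⟩⟩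
  have hmono : Monotone A := fun _ _ hnm _ ⟨k, hk, hω⟩ => ⟨k, hk.trans hnm, hω⟩
  rw [hunion, hmono.measure_iUnion, ENNReal.mul_iSup]
  refine iSup_le fun n => ?_
  have hsub := h.submartingale_norm_sq_partialSum v
  have hsup : A n = {ω | (ε : ℝ) ≤ (Finset.range (n + 1)).sup' Finset.nonempty_range_add_one
      fun k => ‖partialSum ξ v k ω‖ ^ 2} := by
    ext ω
    simp only [A, Set.mem_ofPred_eq, Finset.le_sup'_iff, Finset.mem_range, Nat.lt_succ_iff]
  rw [hsup]
  refine (maximal_ineq hsub (fun _ _ => sq_nonneg _) n).trans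
    ((ENNReal.ofReal_le_ofReal ?_).trans_eq (ENNReal.ofReal_coe_nnreal))
  exact (setIntegral_le_integral (hsub.integrable n) (ae_of_all _ fun _ => sq_nonneg _)).trans
    (h.integral_norm_sq_partialSum_le (hv n))

lemma ae_exists_forall_norm_sq_partialSum_shift_lt (h : IsUnitMartingaleDiff μ 𝒢 ξ)
    (hv : Summable fun i => ‖v i‖₊ ^ 2) {ε : ℝ≥0} (hε : ε ≠ 0) :
    ∀ᵐ ω ∂μ, ∃ m, ∀ k,
      ‖partialSum (fun i => ξ (m + i)) (fun i => v (m + i)) k ω‖ ^ 2 < ε := by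
  simp only [ae_iff, not_exists, not_forall, not_lt]
  set N : Set Ω := {ω | ∀ m, ∃ k,
    ε ≤ ‖partialSum (fun i => ξ (m + i)) (fun i => v (m + i)) k ω‖ ^ 2}
  have hsummable : ∀ m, Summable fun i => ‖v (m + i)‖₊ ^ 2 := fun m => by
    simpa only [add_comm m] using (NNReal.summable_nat_add_iff m).2 hv
  have hle : ∀ m, ε * μ N ≤ ((∑' i, ‖v (m + i)‖₊ ^ 2 : ℝ≥0) : ℝ≥0∞) := fun m =>
    (mul_le_mul_right (measure_mono fun ω (hω : ∀ m, ∃ k, _) => hω m) _).trans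
      ((h.shift m).mul_measure_exists_norm_sq_partialSum_ge_le
        (fun n => (hsummable m).sum_le_tsum _ fun _ _ => zero_le) ε)
  have hlim : Tendsto (fun m => ((∑' i, ‖v (m + i)‖₊ ^ 2 : ℝ≥0) : ℝ≥0∞)) atTop (𝓝 0) := by
    simpa only [add_comm, ENNReal.coe_zero] using
      ENNReal.tendsto_coe.2 (NNReal.tendsto_sum_nat_add fun i => ‖v i‖₊ ^ 2)
  have hzero : ε * μ N ≤ 0 := ge_of_tendsto' hlim hle
  simpa only [nonpos_iff_eq_zero, mul_eq_zero, ENNReal.coe_eq_zero, hε, false_or] using hzero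

theorem ae_cauchySeq_partialSum (h : IsUnitMartingaleDiff μ 𝒢 ξ)
    (hv : Summable fun i => ‖v i‖₊ ^ 2) : ∀ᵐ ω ∂μ, CauchySeq fun n => partialSum ξ v n ω := by
  have htail : ∀ j : ℕ, ∀ᵐ ω ∂μ, ∃ m, ∀ k,
      ‖partialSum (fun i => ξ (m + i)) (fun i => v (m + i)) k ω‖ ^ 2 < (1 / (j + 1) : ℝ≥0) :=
    fun j => h.ae_exists_forall_norm_sq_partialSum_shift_lt hv (by positivity)
  filter_upwards [ae_all_iff.2 htail] with ω hω
  rw [Metric.cauchySeq_iff']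
  intro δ hδ
  obtain ⟨j, hj⟩ := exists_nat_one_div_lt (pow_pos hδ 2)
  obtain ⟨m, hm⟩ := hω j
  refine ⟨m, fun n hn => ?_⟩
  obtain ⟨k, rfl⟩ := Nat.exists_eq_add_of_le hn
  rw [dist_eq_norm, partialSum, partialSum, Finset.sum_range_add, add_sub_cancel_left]
  have hmk := hm k
  push_cast at hmk
  exact lt_of_pow_lt_pow_left₀ 2 hδ.le (hmk.trans hj)

end IsUnitMartingaleDiff

end AlmostSureConvergence

section Filtrations

variable {Ω : Type*} {mΩ : MeasurableSpace Ω} {μ : Measure Ω}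

/-- The filtration whose term at `j` is generated by the `η i` with `i < j`. In contrast to
`Filtration.natural`, the inequality is strict, so that `η j` can be independent of the term at
`j`. -/
def pastFiltration {ι β : Type*} [Preorder ι] [MeasurableSpace β] (η : ι → Ω → β)
    (hη : ∀ i, Measurable (η i)) : Filtration ι mΩ where
  seq j := ⨆ i ∈ Set.Iio j, MeasurableSpace.comap (η i) inferInstance
  mono' _ _ h := biSup_mono fun _ hi => lt_of_lt_of_le hi h
  le' _ := iSup₂_le fun i _ => (hη i).comap_le

lemma measurable_pastFiltration {ι β : Type*} [Preorder ι] [MeasurableSpace β] {η : ι → Ω → β}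
    (hη : ∀ i, Measurable (η i)) {i j : ι} (hij : i < j) :
    Measurable[pastFiltration η hη j] (η i) :=
  (comap_measurable (η i)).mono (le_iSup₂_of_le i hij le_rfl) le_rfl

lemma condExp_pastFiltration_of_iIndepFun [IsFiniteMeasure μ] {ι E : Type*} [Preorder ι]
    [NormedAddCommGroup E] [NormedSpace ℝ E] [CompleteSpace E] [MeasurableSpace E] [BorelSpace E]
    [SecondCountableTopology E] {η : ι → Ω → E} (hη : ∀ i, Measurable (η i))
    (hind : iIndepFun η μ) (i : ι) : μ[η i | pastFiltration η hη i] =ᵐ[μ] fun _ => μ[η i] := by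
  have hindep := indep_iSup_of_disjoint (fun j => (hη j).comap_le) hind (S := {i})
    (T := Set.Iio i) (Set.disjoint_singleton_left.2 (lt_irrefl i))
  rw [iSup_singleton] at hindep
  exact condExp_indep_eq (hη i).comap_le ((pastFiltration η hη).le i)
    (comap_measurable (η i)).stronglyMeasurable hindep

lemma isUnitMartingaleDiff_of_iIndepFun [IsFiniteMeasure μ] {η : ℕ → Ω → ℝ}
    (hη : ∀ i, Measurable (η i)) (hind : iIndepFun η μ) (hmean : ∀ i, ∫ ω, η i ω ∂μ = 0)
    (hbound : ∀ i, ∀ᵐ ω ∂μ, |η i ω| ≤ 1) :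
    IsUnitMartingaleDiff μ (pastFiltration η hη) η where
  stronglyMeasurable i := (measurable_pastFiltration hη i.lt_succ_self).stronglyMeasurable
  condExp_eq_zero i := by
    have hcond := condExp_pastFiltration_of_iIndepFun hη hind i
    rwa [hmean i] at hcond
  abs_le_one := hbound

variable {ℱ : Filtration ℕ mΩ} {S : ℕ → Ω → ℝ} {c : ℕ → ℝ}

lemma isUnitMartingaleDiff_of_martingale (hS : Martingale S ℱ μ)
    (hc : ∀ i, ∀ᵐ ω ∂μ, |S (i + 1) ω - S i ω| ≤ c i) :
    IsUnitMartingaleDiff μ ℱ fun i ω => (c i)⁻¹ * (S (i + 1) ω - S i ω) where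
  stronglyMeasurable i := ((hS.stronglyMeasurable (i + 1)).sub
    ((hS.stronglyMeasurable i).mono (ℱ.mono i.le_succ))).const_mul _
  condExp_eq_zero i := by
    filter_upwards [condExp_smul (μ := μ) (c i)⁻¹ (S (i + 1) - S i) (ℱ i),
      condExp_sub (hS.integrable (i + 1)) (hS.integrable i) (ℱ i), hS.condExp_ae_eq i.le_succ,
      hS.condExp_ae_eq (le_refl i)] with ω hsmul hsub hnext hself
    refine hsmul.trans ?_
    rw [Pi.smul_apply, hsub, Pi.sub_apply, hself, ← Nat.succ_eq_add_one, hnext, sub_self,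
      smul_zero, Pi.zero_apply]
  abs_le_one i := by
    filter_upwards [hc i] with ω hω
    have hci : 0 ≤ c i := (abs_nonneg _).trans hω
    rw [abs_mul, abs_inv, abs_of_nonneg hci]
    exact inv_mul_le_one_of_le₀ hω hci

lemma ae_eq_partialSum_of_abs_sub_le (hzero : ∀ᵐ ω ∂μ, S 0 ω = 0)
    (hc : ∀ i, ∀ᵐ ω ∂μ, |S (i + 1) ω - S i ω| ≤ c i) (n : ℕ) :
    S n =ᵐ[μ] partialSum (fun i ω => (c i)⁻¹ * (S (i + 1) ω - S i ω)) c n := by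
  filter_upwards [hzero, ae_all_iff.2 hc] with ω hzero hω
  have hcancel : ∀ i, ((c i)⁻¹ * (S (i + 1) ω - S i ω)) • c i = S (i + 1) ω - S i ω := by
    intro i
    rcases eq_or_ne (c i) 0 with hci | hci
    · rw [abs_nonpos_iff.1 ((hω i).trans_eq hci), mul_zero, zero_smul]
    · rw [smul_eq_mul, mul_comm, mul_inv_cancel_left₀ hci]
  simp only [partialSum, hcancel, Finset.sum_range_sub (fun i => S i ω), hzero, sub_zero]

lemma ae_nnnorm_le_sqrt_essSup {E : Type*} [NormedAddCommGroup E] {f : Ω → E}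
    (hf : essSup (fun ω => ‖f ω‖ₑ ^ 2) μ ≠ ∞) :
    ∀ᵐ ω ∂μ, ‖f ω‖₊ ≤ NNReal.sqrt (essSup (fun ω => ‖f ω‖ₑ ^ 2) μ).toNNReal := by
  filter_upwards [ae_le_essSup (μ := μ) (f := fun ω => ‖f ω‖ₑ ^ 2)] with ω hω
  exact NNReal.le_sqrt_iff_sq_le.2 (ENNReal.le_toNNReal_of_coe_le (by exact_mod_cast hω) hf)

lemma exists_isUnitMartingaleDiff_partialSum_of_martingale (hS : Martingale S ℱ μ)
    (hzero : ∀ᵐ ω ∂μ, S 0 ω = 0) {r : ℝ≥0}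
    (hr : ∑' i, essSup (fun ω => ‖S (i + 1) ω - S i ω‖ₑ ^ 2) μ ≤ r) :
    ∃ (ξ : ℕ → Ω → ℝ) (c : ℕ → ℝ), IsUnitMartingaleDiff μ ℱ ξ ∧
      (∀ n, ∑ i ∈ Finset.range n, ‖c i‖₊ ^ 2 ≤ r) ∧ ∀ n, S n =ᵐ[μ] partialSum ξ c n := by
  set e : ℕ → ℝ≥0∞ := fun i => essSup (fun ω => ‖S (i + 1) ω - S i ω‖ₑ ^ 2) μ
  have he : ∀ i, e i ≠ ∞ := fun i =>
    ne_top_of_le_ne_top ENNReal.coe_ne_top ((ENNReal.le_tsum i).trans hr)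
  set c : ℕ → ℝ≥0 := fun i => NNReal.sqrt (e i).toNNReal
  have hc : ∀ i, ∀ᵐ ω ∂μ, |S (i + 1) ω - S i ω| ≤ c i := fun i => by
    filter_upwards [ae_nnnorm_le_sqrt_essSup (he i)] with ω hω using hω
  refine ⟨_, fun i => c i, isUnitMartingaleDiff_of_martingale hS hc, fun n => ?_,
    ae_eq_partialSum_of_abs_sub_le hzero hc⟩
  simp only [c, NNReal.nnnorm_eq, NNReal.sq_sqrt]
  rw [← ENNReal.toNNReal_sum fun i _ => he i]
  exact ENNReal.toNNReal_mono ENNReal.coe_ne_top ((ENNReal.sum_le_tsum _).trans hr)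

end Filtrations

section TailBounds

variable {Ω : Type*} {mΩ : MeasurableSpace Ω} {μ : Measure Ω} [IsProbabilityMeasure μ]

theorem IsUnitMartingaleDiff.measureReal_norm_ge_le_twoSidedBound_of_tendsto
    {𝒢 : Filtration ℕ mΩ} {ξ : ℕ → Ω → ℝ} (h : IsUnitMartingaleDiff μ 𝒢 ξ) {E : Type*}
    [NormedAddCommGroup E] [InnerProductSpace ℝ E] {v : ℕ → E}
    (hv : ∀ n, ∑ i ∈ Finset.range n, ‖v i‖₊ ^ 2 ≤ 1) {T : Ω → E}
    (hT : ∀ᵐ ω ∂μ, Tendsto (fun n => partialSum ξ v n ω) atTop (𝓝 (T ω))) {x : ℝ} (hx : 0 < x) :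
    μ.real {ω | x ≤ ‖T ω‖} ≤ twoSidedBound x := by
  refine measureReal_norm_ge_le_of_tendsto (h.aestronglyMeasurable_partialSum v) hT
    (continuousAt_twoSidedBound hx.ne') ?_
  filter_upwards [Ioo_mem_nhdsLT hx] with y hy n
  exact h.measureReal_norm_partialSum_ge_le_twoSidedBound (hv n) hy.1

theorem measureReal_martingale_ge_le {ℱ : Filtration ℕ mΩ} {S : ℕ → Ω → ℝ}
    (hS : Martingale S ℱ μ) (hzero : ∀ᵐ ω ∂μ, S 0 ω = 0)
    (hess : ∑' i, essSup (fun ω => ‖S (i + 1) ω - S i ω‖ₑ ^ 2) μ ≤ 1) (n : ℕ) {x : ℝ}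
    (hx : 0 < x) :
    μ.real {ω | x ≤ S n ω} ≤ oneSidedBound x ∧ μ.real {ω | x ≤ |S n ω|} ≤ twoSidedBound x := by
  obtain ⟨ξ, c, hξ, hc, hSc⟩ :=
    exists_isUnitMartingaleDiff_partialSum_of_martingale hS hzero (r := 1) hess
  have hone : {ω | x ≤ S n ω} =ᵐ[μ] {ω | x ≤ partialSum ξ c n ω} :=
    (hSc n).fun_comp (x ≤ ·)
  have htwo : {ω | x ≤ |S n ω|} =ᵐ[μ] {ω | x ≤ ‖partialSum ξ c n ω‖} :=
    (hSc n).fun_comp (x ≤ |·|)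
  rw [measureReal_congr hone, measureReal_congr htwo]
  exact ⟨hξ.measureReal_partialSum_ge_le_oneSidedBound (hc n) hx,
    hξ.measureReal_norm_partialSum_ge_le_twoSidedBound (hc n) hx⟩

end TailBounds

end BoundedSums

theorem mainTheorem4_general {Ω : Type*} [mΩ : MeasurableSpace Ω] (μ : Measure Ω)
    [IsProbabilityMeasure μ] {𝕜 : Type*} [RCLike 𝕜] {H : Type*} [NormedAddCommGroup H]
    [InnerProductSpace 𝕜 H] :
    (∀ (𝒢 : Filtration ℕ mΩ) (ξ : ℕ → Ω → ℝ) (v : ℕ → H),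
      BoundedSums.IsUnitMartingaleDiff μ 𝒢 ξ →
      (∀ n, ∑ i ∈ Finset.range n, ‖v i‖ ^ 2 ≤ 1) →
      (∀ᵐ ω ∂μ, CauchySeq fun n : ℕ => ∑ i ∈ Finset.range n, (ξ i ω : 𝕜) • v i) ∧
      ∀ T : Ω → H,
        (∀ᵐ ω ∂μ,
          Tendsto (fun n : ℕ => ∑ i ∈ Finset.range n, (ξ i ω : 𝕜) • v i) atTop (𝓝 (T ω))) →
        ∀ x : ℝ, 0 < x → μ.real {ω | x ≤ ‖T ω‖} ≤ BoundedSums.twoSidedBound x) ∧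
    (∀ (ℱ : Filtration ℕ mΩ) (S : ℕ → Ω → ℝ),
      Martingale S ℱ μ →
      (∀ᵐ ω ∂μ, S 0 ω = 0) →
      ∑' i : ℕ, essSup (fun ω => ‖S (i + 1) ω - S i ω‖ₑ ^ 2) μ ≤ 1 →
      ∀ (n : ℕ) (x : ℝ), 0 < x →
        μ.real {ω | x ≤ S n ω} ≤ BoundedSums.oneSidedBound x ∧
        μ.real {ω | x ≤ |S n ω|} ≤ BoundedSums.twoSidedBound x) := by
  refine ⟨fun 𝒢 ξ v h hv => ?_, fun ℱ S hS hzero hess n x hx =>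
    BoundedSums.measureReal_martingale_ge_le hS hzero hess n hx⟩
  let := InnerProductSpace.rclikeToReal 𝕜 H
  have hv' : ∀ n, ∑ i ∈ Finset.range n, ‖v i‖₊ ^ 2 ≤ 1 := fun n =>
    NNReal.coe_le_coe.1 (by
      simpa only [NNReal.coe_sum, NNReal.coe_pow, coe_nnnorm, NNReal.coe_one] using hv n)
  have hsum : ∀ n ω, ∑ i ∈ Finset.range n, (ξ i ω : 𝕜) • v i = BoundedSums.partialSum ξ v n ω :=
    fun n ω => Finset.sum_congr rfl fun i _ => (RCLike.real_smul_eq_coe_smul (ξ i ω) (v i)).symm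
  simp only [hsum]
  exact ⟨h.ae_cauchySeq_partialSum (NNReal.summable_of_sum_range_le hv'),
    fun T hT x hx => h.measureReal_norm_ge_le_twoSidedBound_of_tendsto hv' hT hx⟩

theorem mainTheorem4 {Ω : Type*} [mΩ : MeasurableSpace Ω] (μ : Measure Ω) [IsProbabilityMeasure μ]
    {𝕜 : Type*} [RCLike 𝕜]
    {H : Type*} [NormedAddCommGroup H] [InnerProductSpace 𝕜 H] [CompleteSpace H] :
    (∀ (η : ℕ → Ω → ℝ) (v : ℕ → H),
      (∀ i, Measurable (η i)) →
      iIndepFun η μ →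
      (∀ i, ∫ ω, η i ω ∂μ = 0) →
      (∀ i, ∀ᵐ ω ∂μ, |η i ω| ≤ 1) →
      HasSum (fun i => ‖v i‖ ^ 2) 1 →
      (∀ᵐ ω ∂μ, ∃ s : H,
        Tendsto (fun n : ℕ => ∑ i ∈ Finset.range n, (η i ω : 𝕜) • v i) atTop (𝓝 s)) ∧
      ∀ T : Ω → H,
        (∀ᵐ ω ∂μ,
          Tendsto (fun n : ℕ => ∑ i ∈ Finset.range n, (η i ω : 𝕜) • v i) atTop (𝓝 (T ω))) →
        ∀ x : ℝ, 0 < x → μ.real {ω | x ≤ ‖T ω‖} ≤ BoundedSums.twoSidedBound x) ∧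
    (∀ (ℱ : Filtration ℕ mΩ) (S : ℕ → Ω → ℝ),
      Martingale S ℱ μ →
      (∀ᵐ ω ∂μ, S 0 ω = 0) →
      ∑' i : ℕ, essSup (fun ω => ‖S (i + 1) ω - S i ω‖ₑ ^ 2) μ ≤ 1 →
      ∀ (n : ℕ) (x : ℝ), 0 < x →
        μ.real {ω | x ≤ S n ω} ≤ BoundedSums.oneSidedBound x ∧
        μ.real {ω | x ≤ |S n ω|} ≤ BoundedSums.twoSidedBound x) := by
  obtain ⟨hsums, hmart⟩ := mainTheorem4_general μ (𝕜 := 𝕜) (H := H)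
  refine ⟨fun η v hη hind hmean hbound hv => ?_, hmart⟩
  obtain ⟨hcauchy, htail⟩ := hsums _ η v
    (BoundedSums.isUnitMartingaleDiff_of_iIndepFun hη hind hmean hbound)
    fun n => sum_le_hasSum _ (fun _ _ => sq_nonneg _) hv
  exact ⟨hcauchy.mono fun ω hω => cauchySeq_tendsto_of_complete hω, htail⟩
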